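/- All algebras are unital associative algebras over $\mathbb{C}$; $[x,y]=xy-yx$ and $\{x,y\}=xy+yx$. **Quotiented Racah algebra.** The universal Racah algebra $\mathcal{R}(\alpha_1,\alpha_2,\alpha_3)$ is generated by $A$, $B$ and central elements $\alpha_1,\alpha_2,\alpha_3,C$ subject to $$[B,[A,B]]=-2B^2-2\{A,B\}+2(C+\alpha_1+\alpha_2+\alpha_3)B+2(\alpha_1-C)(\alpha_3-\alpha_2),$$ $$[A,[B,A]]=-2A^2-2\{A,B\}+2(C+\alpha_1+\alpha_2+\alpha_3)A+2(\alpha_1-\alpha_2)(\alpha_3-C).$$ For spins $j_1,j_2,j_3$ put $\mathcal{J}_{ab}=\{|j_a-j_b|,|j_a-j_b|+1,\dots,j_a+j_b\}$, and let $\mathcal{B}_{abc}$ be the set of pairs $(k,\ell)$ with $k\in\mathcal{J}_{ab}$ and $\ell\in\{|k-j_c|,\dots,k+j_c\}$, $\mathcal{J}_{123}$ the set of all $\ell$ occurring in $\mathcal{B}_{123}$, and $\mathcal{M}_{abc}=\{\ell(\ell+1)-k(k+1) : (k,\ell)\in\mathcal{B}_{abc}\}$ (a set, without repetitions). The quotiented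 Racah algebra $\overline{\mathcal{R}}(j_1(j_1+1),j_2(j_2+1),j_3(j_3+1))$ is the quotient of the universal one by the relations $\alpha_i=j_i(j_i+1)$ and $$\prod_{j\in\mathcal{J}_{12}}(A-j(j+1))=0,\quad \prod_{j\in\mathcal{J}_{23}}(B-j(j+1))=0,\quad \prod_{j\in\mathcal{J}_{123}}(C-j(j+1))=0,$$ $$\prod_{j\in\mathcal{J}_{13}}(C-A-B+\alpha_1+\alpha_2+\alpha_3-j(j+1))=0,\quad \prod_{m\in\mathcal{M}_{132}}(A+B-\alpha_1-\alpha_2-\alpha_3-m)=0,$$ $$\prod_{m\in\mathcal{M}_{123}}(C-A-m)=0,\quad \prod_{m\in\mathcal{M}_{231}}(C-B-m)=0.$$ The algebra $\overline{\mathcal{R}}(2,2,2)$ is the case $j_1=j_2=j_3=1$. **Centralizer.** Let $V$ be the $3$-dimensional (spin-$1$) irreducible representation of $\mathfrak{su}(2)$, with generators acting by $s^\alpha$ ($\alpha=1,2,3$), $[s^\alpha,s^\beta]=i\,\epsilon_{\alpha\beta\gamma}s^\gamma$, and let $s_a^\alpha$ be $s^\alpha$ acting on the $a$-th factor of $V\otimes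 V\otimes V$. Let $\mathcal{C}_{111}\subset \mathrm{End}(V^{\otimes 3})$ be the subalgebra of all operators that commute with $s_1^\alpha+s_2^\alpha+s_3^\alpha$ for $\alpha=1,2,3$, and put $K_{12}=\sum_\alpha(s_1^\alpha+s_2^\alpha)^2$, $K_{23}=\sum_\alpha(s_2^\alpha+s_3^\alpha)^2$, $K_{123}=\sum_\alpha(s_1^\alpha+s_2^\alpha+s_3^\alpha)^2$. **Brauer algebra.** $B_3(\eta)$ is generated by $s_1,s_2,e_1,e_2$ subject to $s_i^2=1$, $e_i^2=\eta e_i$, $s_ie_i=e_is_i=e_i$ ($i=1,2$), $s_1s_2s_1=s_2s_1s_2$, $e_1e_2e_1=e_1$, $e_2e_1e_2=e_2$, $s_1e_2e_1=s_2e_1$, $e_2e_1s_2=e_2s_1$. **Theorem.** 1. $\dim_{\mathbb{C}}\overline{\mathcal{R}}(2,2,2)=15$. 2. There is an algebra isomorphism $\overline{\phi}:\overline{\mathcal{R}}(2,2,2)\to\mathcal{C}_{111}$ with $\overline{\phi}(A)=K_{12}$, $\overline{\phi}(B)=K_{23}$, $\overline{\phi}(C)=K_{123}$. 3. There is a unique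 algebra isomorphism $\overline{\mathcal{R}}(2,2,2)\to B_3(3)$ with $A\mapsto 2(s_1-e_1)+4$ and $B\mapsto 2(s_2-e_2)+4$. -/

import Mathlib

open scoped Kronecker

noncomputable section

namespace RacahCentralizer

/-! Spins are encoded by their doubles: `n : ℕ` stands for the spin `j = n / 2`, and `[n]` is the
irreducible representation of `su(2)` of dimension `n + 1`. -/

/-- The eigenvalue `j (j + 1)` of the Casimir on the spin-`j` representation, where `n = 2 j`. -/
def cas (n : ℕ) : ℚ := (n / 2 : ℚ) * (n / 2 + 1)

/-! ### The sets read off the Bratteli diagrams -/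

/-- The set `{|j_a - j_b|, |j_a - j_b| + 1, …, j_a + j_b}` of the spins occurring in `[a] ⊗ [b]`,
where `a = 2 j_a`, `b = 2 j_b` (each spin is again represented by its double). -/
def coupling (a b : ℕ) : Finset ℕ :=
  (Finset.range (a + b + 1)).filter fun n => a ≤ b + n ∧ b ≤ a + n ∧ Even (a + b + n)

/-- The edges `([2k], [2ℓ])` from the second to the third row of the Bratteli diagram of
`[a] ⊗ [b] ⊗ [c]`: the spin `k` occurs in `[a] ⊗ [b]` and `ℓ` occurs in `[2k] ⊗ [c]`. -/
def bratteliEdges (a b c : ℕ) : Finset (ℕ × ℕ) :=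
  (coupling a b).biUnion fun k => (coupling k c).image fun l => (k, l)

/-- The set of the spins occurring in `[a] ⊗ [b] ⊗ [c]`: the third row of the Bratteli diagram. -/
def coupling₃ (a b c : ℕ) : Finset ℕ := (bratteliEdges a b c).image Prod.snd

/-- The Casimir values `j (j + 1)` for `2 j` in `J`. -/
def casValues (J : Finset ℕ) : Finset ℚ := J.image cas

/-- The set `M_{abc}` of the differences `ℓ (ℓ + 1) - k (k + 1)` along the edges `([2k], [2ℓ])`,
as a set, that is, without repetition. -/
def edgeValues (a b c : ℕ) : Finset ℚ := (bratteliEdges a b c).image fun e => cas e.2 - cas e.1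

/-- The value `∏_{c ∈ S} (x - c)` at an element `x` of a complex algebra. -/
def rootProd {R : Type} [Ring R] [Algebra ℂ R] (S : Finset ℚ) (x : R) : R :=
  Polynomial.aeval x (∏ c ∈ S, (Polynomial.X - Polynomial.C (c : ℂ)))

/-! ### The universal Racah algebra and its quotient -/

/-- The generators `A`, `B`, `C`, `α₁`, `α₂`, `α₃` (the latter indexed by `Fin 3`). -/
inductive RacahGen : Type
  | A : RacahGen
  | B : RacahGen
  | C : RacahGen
  | α : Fin 3 → RacahGen

/-- The generators in the free algebra. -/
def freeGen (g : RacahGen) : FreeAlgebra ℂ RacahGen := FreeAlgebra.ι ℂ g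

local notation "𝐀" => freeGen RacahGen.A
local notation "𝐁" => freeGen RacahGen.B
local notation "𝐂" => freeGen RacahGen.C
local notation "𝛂₁" => freeGen (RacahGen.α 0)
local notation "𝛂₂" => freeGen (RacahGen.α 1)
local notation "𝛂₃" => freeGen (RacahGen.α 2)

/-- The defining relations of the universal Racah algebra; `⁅x, y⁆ = x * y - y * x`. -/
inductive RacahRel : FreeAlgebra ℂ RacahGen → FreeAlgebra ℂ RacahGen → Prop
  | central_C (g : RacahGen) : RacahRel (𝐂 * freeGen g) (freeGen g * 𝐂)
  | central_α (i : Fin 3) (g : RacahGen) :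
      RacahRel (freeGen (RacahGen.α i) * freeGen g) (freeGen g * freeGen (RacahGen.α i))
  | racah_B : RacahRel ⁅𝐁, ⁅𝐀, 𝐁⁆⁆
      (-2 * 𝐁 ^ 2 - 2 * (𝐀 * 𝐁 + 𝐁 * 𝐀) + 2 * (𝐂 + 𝛂₁ + 𝛂₂ + 𝛂₃) * 𝐁
        + 2 * (𝛂₁ - 𝐂) * (𝛂₃ - 𝛂₂))
  | racah_A : RacahRel ⁅𝐀, ⁅𝐁, 𝐀⁆⁆
      (-2 * 𝐀 ^ 2 - 2 * (𝐀 * 𝐁 + 𝐁 * 𝐀) + 2 * (𝐂 + 𝛂₁ + 𝛂₂ + 𝛂₃) * 𝐀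
        + 2 * (𝛂₁ - 𝛂₂) * (𝛂₃ - 𝐂))

/-- The universal Racah algebra `R(α₁, α₂, α₃)` over `ℂ`. -/
abbrev RacahAlgebra : Type := RingQuot RacahRel

/-- The generators of the universal Racah algebra. -/
def racahGen (g : RacahGen) : RacahAlgebra := RingQuot.mkAlgHom ℂ RacahRel (freeGen g)

local notation "𝖠" => racahGen RacahGen.A
local notation "𝖡" => racahGen RacahGen.B
local notation "𝖢" => racahGen RacahGen.C
local notation "αsum" =>
  racahGen (RacahGen.α 0) + racahGen (RacahGen.α 1) + racahGen (RacahGen.α 2)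

/-- The relations of the quotiented Racah algebra for the spins `n₁ / 2`, `n₂ / 2`, `n₃ / 2`. -/
inductive QuotientRel (n₁ n₂ n₃ : ℕ) : RacahAlgebra → RacahAlgebra → Prop
  | alpha₁ : QuotientRel n₁ n₂ n₃ (racahGen (RacahGen.α 0)) (algebraMap ℂ _ (cas n₁ : ℂ))
  | alpha₂ : QuotientRel n₁ n₂ n₃ (racahGen (RacahGen.α 1)) (algebraMap ℂ _ (cas n₂ : ℂ))
  | alpha₃ : QuotientRel n₁ n₂ n₃ (racahGen (RacahGen.α 2)) (algebraMap ℂ _ (cas n₃ : ℂ))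
  | char_A : QuotientRel n₁ n₂ n₃ (rootProd (casValues (coupling n₁ n₂)) 𝖠) 0
  | char_B : QuotientRel n₁ n₂ n₃ (rootProd (casValues (coupling n₂ n₃)) 𝖡) 0
  | char_C : QuotientRel n₁ n₂ n₃ (rootProd (casValues (coupling₃ n₁ n₂ n₃)) 𝖢) 0
  | char_CAB :
      QuotientRel n₁ n₂ n₃ (rootProd (casValues (coupling n₁ n₃)) (𝖢 - 𝖠 - 𝖡 + (αsum))) 0
  | char_AB : QuotientRel n₁ n₂ n₃ (rootProd (edgeValues n₁ n₃ n₂) (𝖠 + 𝖡 - (αsum))) 0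
  | char_CA : QuotientRel n₁ n₂ n₃ (rootProd (edgeValues n₁ n₂ n₃) (𝖢 - 𝖠)) 0
  | char_CB : QuotientRel n₁ n₂ n₃ (rootProd (edgeValues n₂ n₃ n₁) (𝖢 - 𝖡)) 0

/-- The quotiented Racah algebra `R̄(j₁(j₁+1), j₂(j₂+1), j₃(j₃+1))`, where `nᵢ = 2 jᵢ`. -/
abbrev QuotientRacah (n₁ n₂ n₃ : ℕ) : Type := RingQuot (QuotientRel n₁ n₂ n₃)

/-- The image of a generator in the quotiented Racah algebra. -/
def quotGen (n₁ n₂ n₃ : ℕ) (g : RacahGen) : QuotientRacah n₁ n₂ n₃ :=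
  RingQuot.mkAlgHom ℂ (QuotientRel n₁ n₂ n₃) (racahGen g)

/-! ### The representations of `su(2)` and the centralizer -/

/-- The raising operator `𝔰¹ + i 𝔰²` on `[n]` in a basis of weight vectors `v₀, …, vₙ`:
`vₖ₊₁ ↦ (n - k) vₖ`. -/
def raising (n : ℕ) : Matrix (Fin (n + 1)) (Fin (n + 1)) ℂ :=
  Matrix.of fun r c => if (r : ℕ) + 1 = c then (n : ℂ) - (r : ℕ) else 0

/-- The lowering operator `𝔰¹ - i 𝔰²` on `[n]`: `vₖ ↦ (k + 1) vₖ₊₁`. -/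
def lowering (n : ℕ) : Matrix (Fin (n + 1)) (Fin (n + 1)) ℂ :=
  Matrix.of fun r c => if (c : ℕ) + 1 = r then ((r : ℕ) : ℂ) else 0

/-- The images `s¹, s², s³` (indexed by `0, 1, 2`) of the generators of `su(2)` on `[n]`, with
`[s¹, s²] = i s³` and its cyclic permutations; for `n = 1` they are half the Pauli matrices. -/
def spin (n : ℕ) : Fin 3 → Matrix (Fin (n + 1)) (Fin (n + 1)) ℂ :=
  ![(1 / 2 : ℂ) • (raising n + lowering n),
    (-Complex.I / 2) • (raising n - lowering n),
    Matrix.diagonal fun k => (n : ℂ) / 2 - (k : ℕ)]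

/-- `End([n₁] ⊗ [n₂] ⊗ [n₃])`, as matrices in the product basis. -/
abbrev EndTensor (n₁ n₂ n₃ : ℕ) : Type :=
  Matrix (Fin (n₁ + 1) × Fin (n₂ + 1) × Fin (n₃ + 1))
    (Fin (n₁ + 1) × Fin (n₂ + 1) × Fin (n₃ + 1)) ℂ

/-- The operators `s₁^α ⊗ 1 ⊗ 1`, `1 ⊗ s₂^α ⊗ 1`, `1 ⊗ 1 ⊗ s₃^α`; the first argument of
`siteSpin` is the tensor factor, indexed by `0, 1, 2`. -/
def siteSpin (n₁ n₂ n₃ : ℕ) : Fin 3 → Fin 3 → EndTensor n₁ n₂ n₃ :=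
  ![fun α => spin n₁ α ⊗ₖ (1 ⊗ₖ 1), fun α => 1 ⊗ₖ (spin n₂ α ⊗ₖ 1), fun α => 1 ⊗ₖ (1 ⊗ₖ spin n₃ α)]

/-- The Casimir `∑_α (∑_{a ∈ T} s_a^α)²` of a set `T` of tensor factors. -/
def casimir (n₁ n₂ n₃ : ℕ) (T : Finset (Fin 3)) : EndTensor n₁ n₂ n₃ :=
  ∑ α : Fin 3, (∑ a ∈ T, siteSpin n₁ n₂ n₃ a α) ^ 2

/-- The centralizer of the image of `su(2)` in `End([n₁] ⊗ [n₂] ⊗ [n₃])`. -/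
def spinCentralizer (n₁ n₂ n₃ : ℕ) : Subalgebra ℂ (EndTensor n₁ n₂ n₃) :=
  Subalgebra.centralizer ℂ
    (Set.range fun α : Fin 3 =>
      siteSpin n₁ n₂ n₃ 0 α + siteSpin n₁ n₂ n₃ 1 α + siteSpin n₁ n₂ n₃ 2 α)

/-! ### The Brauer algebra -/

/-- The generators `s₁, s₂, e₁, e₂`. -/
inductive BrauerGen : Type
  | s₁ : BrauerGen
  | s₂ : BrauerGen
  | e₁ : BrauerGen
  | e₂ : BrauerGen

local notation "𝐬₁" => FreeAlgebra.ι ℂ BrauerGen.s₁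
local notation "𝐬₂" => FreeAlgebra.ι ℂ BrauerGen.s₂
local notation "𝐞₁" => FreeAlgebra.ι ℂ BrauerGen.e₁
local notation "𝐞₂" => FreeAlgebra.ι ℂ BrauerGen.e₂

/-- The defining relations of the Brauer algebra `B₃(η)`. -/
inductive BrauerRel (η : ℂ) : FreeAlgebra ℂ BrauerGen → FreeAlgebra ℂ BrauerGen → Prop
  | s₁_sq : BrauerRel η (𝐬₁ ^ 2) 1
  | s₂_sq : BrauerRel η (𝐬₂ ^ 2) 1
  | e₁_sq : BrauerRel η (𝐞₁ ^ 2) (η • 𝐞₁)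
  | e₂_sq : BrauerRel η (𝐞₂ ^ 2) (η • 𝐞₂)
  | s₁_e₁ : BrauerRel η (𝐬₁ * 𝐞₁) 𝐞₁
  | e₁_s₁ : BrauerRel η (𝐞₁ * 𝐬₁) 𝐞₁
  | s₂_e₂ : BrauerRel η (𝐬₂ * 𝐞₂) 𝐞₂
  | e₂_s₂ : BrauerRel η (𝐞₂ * 𝐬₂) 𝐞₂
  | braid : BrauerRel η (𝐬₁ * 𝐬₂ * 𝐬₁) (𝐬₂ * 𝐬₁ * 𝐬₂)
  | e₁_e₂_e₁ : BrauerRel η (𝐞₁ * 𝐞₂ * 𝐞₁) 𝐞₁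
  | e₂_e₁_e₂ : BrauerRel η (𝐞₂ * 𝐞₁ * 𝐞₂) 𝐞₂
  | s₁_e₂_e₁ : BrauerRel η (𝐬₁ * 𝐞₂ * 𝐞₁) (𝐬₂ * 𝐞₁)
  | e₂_e₁_s₂ : BrauerRel η (𝐞₂ * 𝐞₁ * 𝐬₂) (𝐞₂ * 𝐬₁)

/-- The Brauer algebra `B₃(η)`. -/
abbrev BrauerAlgebra (η : ℂ) : Type := RingQuot (BrauerRel η)

/-- The generators of the Brauer algebra. -/
def brauerGen (η : ℂ) (g : BrauerGen) : BrauerAlgebra η :=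
  RingQuot.mkAlgHom ℂ (BrauerRel η) (FreeAlgebra.ι ℂ g)

end RacahCentralizer

end

set_option linter.unusedSimpArgs false
set_option linter.unnecessarySeqFocus false

namespace RacahCentralizer

/-! The quotient algebra, the Brauer algebra and the centralizer are compared through the spectral
projections of `A`. Its spectrum lies in {0, 2, 6}, and on two spin-1 factors the projections onto
the spins 0, 1, 2 give the flip as p₀ - p₂ + p₆ and the contraction as 3p₀. Conversely 2(s - e) + 4
recovers the Casimir. These formulas are inverse to each other, so the first isomorphism reduces to
showing that each set of relations implies the other.

From Brauer to Racah this is a computation with a rewriting system on fifteen words. The other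
direction is the core. Sandwiching the Racah relation between eigenprojections of `A` determines the
blocks p₂Bp₂ and p₆Bp₆ and kills p₀Bp₆ and p₆Bp₀, but says nothing about z = p₀Bp₀. The second
relation and the cubic for `B` then give a cubic for z with coefficients in `C`. The element D = C -
A - B + 6, which plays the role of K₁₃, satisfies the same relations as `B`, and p₀Dp₀ = (C + 6)p₀ -
z. Both cubics, together with the pairs of eigenvalues excluded by the degree-six relations, leave
only C = 2 and z = 4 on the image of p₀ (`IsRacahTriple.eigenvalue`). From this follows that
conjugation by the flip takes `B` to D (`IsRacahTriple.swapOf_mul`), and then every Brauer relation.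

For the dimension, fifteen words span the Brauer algebra (`span_normalWord_brauerGen`), and their
images on the tensor cube are independent (`linearIndependent_normalWord`), so the representation is
faithful. An intertwiner is determined by its action on highest-weight vectors, whose multiplicities
for spins 3, 2, 1, 0 are 1, 2, 3, 1, so the centralizer has dimension at most 1 + 4 + 9 + 1 = 15
(`finrank_spinCentralizer_le`). The faithful image therefore fills it. -/

/-- Elements `A`, `B`, `C` of a complex algebra satisfying the relations of the quotiented Racah
algebra for the spins `1, 1, 1`. -/
structure IsRacahTriple {R : Type*} [Ring R] [Algebra ℂ R] (A B C : R) : Prop where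
  comm_A : C * A = A * C
  comm_B : C * B = B * C
  rel_A : 2 * A * B * A - A ^ 2 * B - B * A ^ 2 = -2 * A ^ 2 - 2 * (A * B + B * A) + 2 * (C + 6) * A
  rel_B : 2 * B * A * B - B ^ 2 * A - A * B ^ 2 = -2 * B ^ 2 - 2 * (A * B + B * A) + 2 * (C + 6) * B
  char_A : A * (A - 2) * (A - 6) = 0
  char_B : B * (B - 2) * (B - 6) = 0
  char_D : (C - A - B + 6) * (C - A - B + 6 - 2) * (C - A - B + 6 - 6) = 0
  char_C : C * (C - 2) * (C - 6) * (C - 12) = 0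
  char_CA : (C - A + 4) * (C - A + 2) * (C - A) * (C - A - 2) * (C - A - 4) * (C - A - 6) = 0
  char_CB : (C - B + 4) * (C - B + 2) * (C - B) * (C - B - 2) * (C - B - 4) * (C - B - 6) = 0
  char_CD : (A + B - 6 + 4) * (A + B - 6 + 2) * (A + B - 6) * (A + B - 6 - 2) * (A + B - 6 - 4) *
    (A + B - 6 - 6) = 0

/-! ### Joint spectra of commuting elements -/

section Commutative

/-- On the joint spectrum the difference c - a cannot be 12 or -6. This excludes the pairs (a, c) =
(0, 12) and (6, 0), and the two conclusions record exactly these exclusions. -/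
theorem char_mul_of_char {S : Type*} [CommRing S] [Algebra ℂ S] (a c : S)
    (ha : a * (a - 2) * (a - 6) = 0) (hc : c * (c - 2) * (c - 6) * (c - 12) = 0)
    (hca : (c - a + 4) * (c - a + 2) * (c - a) * (c - a - 2) * (c - a - 4) * (c - a - 6) = 0) :
    c * (c - 2) * (c - 6) * ((a - 2) * (a - 6)) = 0 ∧
      (c - 2) * (c - 6) * (c - 12) * (a * (a - 2)) = 0 := by
  -- This allows `grind` to cancel integer factors.
  have : IsAddTorsionFree S := .of_isTorsionFree ℂ S
  constructor <;> grind

/-- Here p stands for p₀, z for p₀Bp₀ and z' = (c + 6)p - z for p₀Dp₀. On p there are three cases.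
If c = 0, then `h3` and `h4` make both z and 6 - z square to zero, which is impossible. If c = 6,
then z and 12 - z must both lie in {0, -3}, which is impossible. If c = 2, then z and 8 - z lie in
{0, 4, -1}, so z = 4. -/
theorem eigenvalue_of_char {S : Type*} [CommRing S] [Algebra ℂ S] (p z c : S) (hp : p * p = p)
    (hz : p * z = z)
    (hc : c * (c - 2) * (c - 6) * p = 0)
    (h1 : z * (z + (c - 6) * p) * (2 * z + c * p) = 0)
    (h2 : (c * p + 6 * p - z) * ((c * p + 6 * p - z) + (c - 6) * p) *
      (2 * (c * p + 6 * p - z) + c * p) = 0)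
    (h3 : (c - 2) * (c - 6) * (c - 12) * (2 * z ^ 2 + c * z) = 0)
    (h4 : (c - 2) * (c - 6) * (c - 12) * (2 * (c * p + 6 * p - z) ^ 2 + c * (c * p + 6 * p - z)) =
      0) :
    c * p = 2 * p ∧ z = 4 * p := by
  have : IsAddTorsionFree S := .of_isTorsionFree ℂ S
  have hcp : c * p = 2 * p := by grind
  exact ⟨hcp, by grind⟩

open Algebra
open scoped IsMulCommutative

theorem _root_.Commute.char_mul_of_char {R : Type*} [Ring R] [Algebra ℂ R] {a c : R}
    (h : Commute c a) (ha : a * (a - 2) * (a - 6) = 0)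
    (hc : c * (c - 2) * (c - 6) * (c - 12) = 0)
    (hca : (c - a + 4) * (c - a + 2) * (c - a) * (c - a - 2) * (c - a - 4) * (c - a - 6) = 0) :
    c * (c - 2) * (c - 6) * ((a - 2) * (a - 6)) = 0 ∧
      (c - 2) * (c - 6) * (c - 12) * (a * (a - 2)) = 0 := by
  -- The subalgebra generated by commuting elements is commutative, so the commutative version
  -- applies inside it.
  have := isMulCommutative_adjoin ℂ (s := {a, c}) (by simp [h.eq])
  let a' : adjoin ℂ {a, c} := ⟨a, subset_adjoin (by simp)⟩
  let c' : adjoin ℂ {a, c} := ⟨c, subset_adjoin (by simp)⟩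
  have key := RacahCentralizer.char_mul_of_char a' c' (Subtype.ext ha) (Subtype.ext hc)
    (Subtype.ext hca)
  exact ⟨congrArg Subtype.val key.1, congrArg Subtype.val key.2⟩

theorem _root_.Commute.eigenvalue_of_char {R : Type*} [Ring R] [Algebra ℂ R] {p z c : R}
    (hcp : Commute c p) (hcz : Commute c z) (hp : p * p = p)
    (hz : p * z = z) (hz' : z * p = z)
    (hc : c * (c - 2) * (c - 6) * p = 0)
    (h1 : z * (z + (c - 6) * p) * (2 * z + c * p) = 0)
    (h2 : (c * p + 6 * p - z) * ((c * p + 6 * p - z) + (c - 6) * p) *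
      (2 * (c * p + 6 * p - z) + c * p) = 0)
    (h3 : (c - 2) * (c - 6) * (c - 12) * (2 * z ^ 2 + c * z) = 0)
    (h4 : (c - 2) * (c - 6) * (c - 12) * (2 * (c * p + 6 * p - z) ^ 2 + c * (c * p + 6 * p - z)) =
      0) :
    c * p = 2 * p ∧ z = 4 * p := by
  have := isMulCommutative_adjoin ℂ (s := {p, z, c}) (by simp [hcp.eq, hcz.eq, hz, hz'])
  let p' : adjoin ℂ {p, z, c} := ⟨p, subset_adjoin (by simp)⟩
  let z' : adjoin ℂ {p, z, c} := ⟨z, subset_adjoin (by simp)⟩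
  let c' : adjoin ℂ {p, z, c} := ⟨c, subset_adjoin (by simp)⟩
  have key := RacahCentralizer.eigenvalue_of_char p' z' c' (Subtype.ext hp) (Subtype.ext hz)
    (Subtype.ext hc)
    (Subtype.ext h1) (Subtype.ext h2) (Subtype.ext h3) (Subtype.ext h4)
  exact ⟨congrArg Subtype.val key.1, congrArg Subtype.val key.2⟩

end Commutative

/-! ### Symmetries of the Racah relations -/

namespace IsRacahTriple
variable {R : Type*} [Ring R] [Algebra ℂ R] {A B C : R}

theorem symm (h : IsRacahTriple A B C) : IsRacahTriple B A C where
  comm_A := h.comm_B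
  comm_B := h.comm_A
  rel_A := by rw [h.rel_B, add_comm (A * B)]
  rel_B := by rw [h.rel_A, add_comm (A * B)]
  char_A := h.char_B
  char_B := h.char_A
  char_D := by rw [sub_right_comm C B A]; exact h.char_D
  char_C := h.char_C
  char_CA := h.char_CB
  char_CB := h.char_CA
  char_CD := by rw [add_comm B A]; exact h.char_CD

/-- This is the exchange of the tensor factors 1 and 2: it fixes K₁₂ and K₁₂₃ and replaces K₂₃ by
K₁₃ = C - A - B + 6. Every statement about `B` thereby yields one about K₁₃. -/
theorem rotate (h : IsRacahTriple A B C) : IsRacahTriple A (C - A - B + 6) C where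
  comm_A := h.comm_A
  comm_B := by
    linear_combination (norm := noncomm_ring) - h.comm_A - h.comm_B
  rel_A := by
    linear_combination (norm := noncomm_ring) 
      - h.rel_A + A * h.comm_A - h.comm_A * A - 2 * h.comm_A
  rel_B := by
    have rA : ∀ x, A * (C * x) = C * (A * x) := (Commute.left_comm h.comm_A · |>.symm)
    have rB : ∀ x, B * (C * x) = C * (B * x) := (Commute.left_comm h.comm_B · |>.symm)
    have n : (36 : ℤ) • (2 : R) = 12 • 6 := by norm_num
    linear_combination (norm := skip) h.rel_B - h.rel_A
    noncomm_ring
    simp only [← h.comm_A, ← h.comm_B, rA, rB, n]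
    abel
  char_A := h.char_A
  char_B := h.char_D
  char_D := by
    convert h.char_B using 3 <;> abel
  char_C := h.char_C
  char_CA := h.char_CA
  char_CB := by
    convert h.char_CD using 3 <;> abel_nf
  char_CD := by
    convert h.char_CB using 3 <;> abel_nf

/-- The relations are invariant under reversal of words, so identities with the factors in the
opposite order come for free. -/
theorem op (h : IsRacahTriple A B C) :
    IsRacahTriple (MulOpposite.op A) (MulOpposite.op B) (MulOpposite.op C) := by
  have cubic (X : R) (hX : X * (X - 2) * (X - 6) = 0) : (X - 6) * ((X - 2) * X) = 0 := by
    linear_combination (norm := noncomm_ring) hX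
  have sextic (X : R) (hX : (X + 4) * (X + 2) * X * (X - 2) * (X - 4) * (X - 6) = 0) :
      (X - 6) * ((X - 4) * ((X - 2) * (X * ((X + 2) * (X + 4))))) = 0 := by
    linear_combination (norm := noncomm_ring) hX
  refine ⟨congrArg MulOpposite.op h.comm_A.symm, congrArg MulOpposite.op h.comm_B.symm,
    MulOpposite.unop_injective ?_, MulOpposite.unop_injective ?_,
    congrArg MulOpposite.op (cubic A h.char_A), congrArg MulOpposite.op (cubic B h.char_B),
    congrArg MulOpposite.op (cubic (C - A - B + 6) h.char_D), MulOpposite.unop_injective ?_,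
    congrArg MulOpposite.op (sextic (C - A) h.char_CA),
    congrArg MulOpposite.op (sextic (C - B) h.char_CB),
    congrArg MulOpposite.op (sextic (A + B - 6) h.char_CD)⟩
  · change A * (B * (A * 2)) - B * A ^ 2 - A ^ 2 * B =
      A ^ 2 * (-2) - (B * A + A * B) * 2 + A * ((C + 6) * 2)
    linear_combination (norm := noncomm_ring) h.rel_A + 2 * h.comm_A
  · change B * (A * (B * 2)) - A * B ^ 2 - B ^ 2 * A =
      B ^ 2 * (-2) - (B * A + A * B) * 2 + B * ((C + 6) * 2)
    linear_combination (norm := noncomm_ring) h.rel_B + 2 * h.comm_B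
  · change (C - 12) * ((C - 6) * ((C - 2) * C)) = 0
    linear_combination (norm := noncomm_ring) h.char_C

end IsRacahTriple

/-! ### Spectral projections of an element with spectrum in {0, 2, 6} -/

section Projections
variable {R : Type*} [Ring R] [Algebra ℂ R]

/-- The spectral projection on the eigenvalue `0` of an element with spectrum `{0, 2, 6}`. -/
noncomputable def proj₀ (X : R) : R := (1 / 12 : ℂ) • ((X - 2) * (X - 6))

/-- The spectral projection on the eigenvalue `2` of an element with spectrum `{0, 2, 6}`. -/
noncomputable def proj₂ (X : R) : R := (-1 / 8 : ℂ) • (X * (X - 6))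

/-- The spectral projection on the eigenvalue `6` of an element with spectrum `{0, 2, 6}`. -/
noncomputable def proj₆ (X : R) : R := (1 / 24 : ℂ) • (X * (X - 2))

theorem _root_.Commute.proj₀ {c X : R} (h : Commute c X) : Commute c (proj₀ X) :=
  ((h.sub_right (Commute.ofNat_right c 2)).mul_right
    (h.sub_right (Commute.ofNat_right c 6))).smul_right _

theorem _root_.Commute.proj₂ {c X : R} (h : Commute c X) : Commute c (proj₂ X) :=
  (h.mul_right (h.sub_right (Commute.ofNat_right c 6))).smul_right _

theorem _root_.Commute.proj₆ {c X : R} (h : Commute c X) : Commute c (proj₆ X) :=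
  (h.mul_right (h.sub_right (Commute.ofNat_right c 2))).smul_right _

theorem ofNat_eq_smul_one (n : ℕ) [n.AtLeastTwo] :
    (OfNat.ofNat n : R) = (OfNat.ofNat n : ℂ) • (1 : R) := by
  rw [← map_ofNat (algebraMap ℂ R) n, Algebra.algebraMap_eq_smul_one]

theorem cube_eq_of_char {X : R} (hX : X * (X - 2) * (X - 6) = 0) :
    X * (X * X) = (8 : ℂ) • (X * X) - (12 : ℂ) • X := by
  have h := hX
  simp only [ofNat_eq_smul_one (R := R), mul_sub, sub_mul, smul_mul_assoc, mul_smul_comm, mul_one,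
    one_mul, mul_assoc] at h
  linear_combination (norm := module) h

theorem proj_sum (X : R) : proj₀ X + proj₂ X + proj₆ X = 1 := by
  simp only [proj₀, proj₂, proj₆, ofNat_eq_smul_one (R := R), mul_sub, sub_mul, smul_mul_assoc,
    mul_smul_comm, mul_one, one_mul, mul_assoc]
  module

theorem eq_proj (X : R) : X = (2 : ℂ) • proj₂ X + (6 : ℂ) • proj₆ X := by
  simp only [proj₂, proj₆, ofNat_eq_smul_one (R := R), mul_sub, sub_mul, smul_mul_assoc,
    mul_smul_comm, mul_one, one_mul, mul_assoc]
  module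

variable {X : R}

theorem mul_proj₀ (hX : X * (X - 2) * (X - 6) = 0) : X * proj₀ X = (0 : ℂ) • proj₀ X := by
  have h := cube_eq_of_char hX
  simp only [proj₀, ofNat_eq_smul_one (R := R), mul_sub, sub_mul, smul_mul_assoc, mul_smul_comm,
    mul_one,
    one_mul, mul_assoc, h]
  module

theorem mul_proj₂ (hX : X * (X - 2) * (X - 6) = 0) : X * proj₂ X = (2 : ℂ) • proj₂ X := by
  have h := cube_eq_of_char hX
  simp only [proj₂, ofNat_eq_smul_one (R := R), mul_sub, sub_mul, smul_mul_assoc, mul_smul_comm,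
    mul_one,
    one_mul, mul_assoc, h]
  module

theorem mul_proj₆ (hX : X * (X - 2) * (X - 6) = 0) : X * proj₆ X = (6 : ℂ) • proj₆ X := by
  have h := cube_eq_of_char hX
  simp only [proj₆, ofNat_eq_smul_one (R := R), mul_sub, sub_mul, smul_mul_assoc, mul_smul_comm,
    mul_one,
    one_mul, mul_assoc, h]
  module

theorem proj₀_comm : proj₀ X * X = X * proj₀ X := by
  simp only [proj₀, ofNat_eq_smul_one (R := R), mul_sub, sub_mul, smul_mul_assoc, mul_smul_comm,
    mul_one,
    one_mul, mul_assoc]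

theorem proj₂_comm : proj₂ X * X = X * proj₂ X := by
  simp only [proj₂, ofNat_eq_smul_one (R := R), mul_sub, sub_mul, smul_mul_assoc, mul_smul_comm,
    mul_one,
    one_mul, mul_assoc]

theorem proj₆_comm : proj₆ X * X = X * proj₆ X := by
  simp only [proj₆, ofNat_eq_smul_one (R := R), mul_sub, sub_mul, smul_mul_assoc, mul_smul_comm,
    mul_one,
    one_mul, mul_assoc]

theorem proj₀_idem (hX : X * (X - 2) * (X - 6) = 0) : proj₀ X * proj₀ X = proj₀ X := by
  have h := mul_proj₀ hX
  conv_lhs => enter [1]; rw [proj₀]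
  simp only [ofNat_eq_smul_one (R := R), sub_mul, smul_mul_assoc, mul_sub, mul_smul_comm, one_mul,
    mul_one, mul_assoc, h]
  module

theorem proj₂_idem (hX : X * (X - 2) * (X - 6) = 0) : proj₂ X * proj₂ X = proj₂ X := by
  have h := mul_proj₂ hX
  conv_lhs => enter [1]; rw [proj₂]
  simp only [ofNat_eq_smul_one (R := R), sub_mul, smul_mul_assoc, mul_sub, mul_smul_comm, one_mul,
    mul_one, mul_assoc, h]
  module

theorem proj₀_mul_proj₆ (hX : X * (X - 2) * (X - 6) = 0) : proj₀ X * proj₆ X = 0 := by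
  have : (6 : ℂ) • (proj₀ X * proj₆ X) = (0 : ℂ) • (proj₀ X * proj₆ X) := by
    rw [← mul_smul_comm, ← mul_proj₆ hX, ← smul_mul_assoc, ← mul_proj₀ hX,
      ← proj₀_comm, mul_assoc]
  simpa using this

theorem proj₆_idem (hX : X * (X - 2) * (X - 6) = 0) : proj₆ X * proj₆ X = proj₆ X := by
  have h := mul_proj₆ hX
  conv_lhs => enter [1]; rw [proj₆]
  simp only [ofNat_eq_smul_one (R := R), sub_mul, smul_mul_assoc, mul_sub, mul_smul_comm, one_mul,
    mul_one, mul_assoc, h]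
  module

theorem proj₆_mul_proj₀ (hX : X * (X - 2) * (X - 6) = 0) : proj₆ X * proj₀ X = 0 := by
  rw [(show Commute (proj₆ X) X from proj₆_comm).proj₀.eq, proj₀_mul_proj₆ hX]

end Projections

/-! ### Blocks of `B` with respect to the projections of `A` -/

namespace IsRacahTriple
variable {R : Type*} [Ring R] [Algebra ℂ R] {A B C : R}

/-- Between an i-eigenvector on the left and a j-eigenvector on the right, `rel_A` becomes linear in
uBv, with coefficient 2(i + j) - (i - j)². It vanishes for {i, j} = {0}, {0, 2} and {2, 6}, so those
blocks stay undetermined; the others are computed below. -/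
theorem sandwich (h : IsRacahTriple A B C) {u v : R} {i j : ℂ} (hu : u * A = i • u)
    (hv : A * v = j • v) (huC : Commute C u) :
    (2 * i * j - i ^ 2 - j ^ 2 + 2 * i + 2 * j) • (u * B * v) =
      ((2 : ℂ) * j) • (C * (u * v)) + (12 * j - 2 * j ^ 2) • (u * v) := by
  have t1 : u * A * B * A * v = (i * j) • (u * B * v) := by
    rw [mul_assoc _ A v, hu, hv]; simp [smul_smul, mul_comm]
  have t2 : u * A * A * B * v = (i * i) • (u * B * v) := by simp [hu, smul_smul]
  have t3 : u * B * A * A * v = (j * j) • (u * B * v) := by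
    simp [mul_assoc, hv, smul_smul]
  have t4 : u * A * A * v = (j * j) • (u * v) := by simp [mul_assoc, hv, smul_smul]
  have t5 : u * A * B * v = i • (u * B * v) := by simp [hu]
  have t6 : u * B * A * v = j • (u * B * v) := by simp [mul_assoc, hv]
  have t7 : u * C * A * v = j • (u * C * v) := by simp [mul_assoc, hv]
  have t8 : u * A * v = j • (u * v) := by simp [mul_assoc, hv]
  have key : 2 * (u * A * B * A * v) - u * A * A * B * v - u * B * A * A * v =
      -2 * (u * A * A * v) - 2 * (u * A * B * v + u * B * A * v) +
      2 * (u * C * A * v) + 12 * (u * A * v) := by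
    linear_combination (norm := noncomm_ring) u * h.rel_A * v
  rw [t1, t2, t3, t4, t5, t6, t7, t8] at key
  simp only [two_mul, neg_mul, show ∀ x : R, 12 * x = (12 : ℂ) • x from
    fun x => by rw [← map_ofNat (algebraMap ℂ R) 12, Algebra.smul_def]] at key
  rw [← huC.eq, mul_assoc C] at key
  linear_combination (norm := module) key

theorem commute_A (h : IsRacahTriple A B C) : Commute C A := h.comm_A

theorem commute_B (h : IsRacahTriple A B C) : Commute C B := h.comm_B

theorem proj₀_mul_mul_proj₆ (h : IsRacahTriple A B C) : proj₀ A * B * proj₆ A = 0 := by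
  have key := h.sandwich (u := proj₀ A) (v := proj₆ A) (i := 0) (j := 6)
    (by rw [proj₀_comm, mul_proj₀ h.char_A]) (mul_proj₆ h.char_A) h.commute_A.proj₀
  rw [proj₀_mul_proj₆ h.char_A] at key
  norm_num at key
  exact key

theorem proj₆_mul_mul_proj₀ (h : IsRacahTriple A B C) : proj₆ A * B * proj₀ A = 0 := by
  have key := h.sandwich (u := proj₆ A) (v := proj₀ A) (i := 6) (j := 0)
    (by rw [proj₆_comm, mul_proj₆ h.char_A]) (mul_proj₀ h.char_A) h.commute_A.proj₆
  rw [proj₆_mul_proj₀ h.char_A] at key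
  norm_num at key
  exact key

theorem proj₂_mul_mul_proj₂ (h : IsRacahTriple A B C) :
    proj₂ A * B * proj₂ A = (1 / 2 : ℂ) • (C * proj₂ A) + (2 : ℂ) • proj₂ A := by
  have key := h.sandwich (u := proj₂ A) (v := proj₂ A) (i := 2) (j := 2)
    (by rw [proj₂_comm, mul_proj₂ h.char_A]) (mul_proj₂ h.char_A) h.commute_A.proj₂
  rw [proj₂_idem h.char_A] at key
  linear_combination (norm := module) (1 / 8 : ℂ) • key

theorem proj₆_mul_mul_proj₆ (h : IsRacahTriple A B C) : proj₆ A * B * proj₆ A = (1 / 2 :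
    ℂ) • (C * proj₆ A) := by
  have key := h.sandwich (u := proj₆ A) (v := proj₆ A) (i := 6) (j := 6)
    (by rw [proj₆_comm, mul_proj₆ h.char_A]) (mul_proj₆ h.char_A) h.commute_A.proj₆
  rw [proj₆_idem h.char_A] at key
  linear_combination (norm := module) (1 / 24 : ℂ) • key

theorem corner_square (h : IsRacahTriple A B C) : proj₀ A * B * B * proj₀ A =
    proj₀ A * B * proj₀ A * (proj₀ A * B * proj₀ A) + proj₀ A * B * proj₂ A * B * proj₀ A := by
  have e : B * B = B * (proj₀ A * proj₀ A + proj₂ A + proj₆ A) * B := by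
    rw [proj₀_idem h.char_A, proj_sum, mul_one]
  rw [mul_assoc (proj₀ A), e]
  linear_combination (norm := noncomm_ring) h.proj₀_mul_mul_proj₆ * B * proj₀ A

/-- This is `rel_B` sandwiched between two copies of p₀. Since A = 2p₂ + 6p₆ and p₀Bp₆ = 0, the term
BAB contributes only the path through p₂. -/
theorem corner_linear (h : IsRacahTriple A B C) : (6 : ℂ) • (proj₀ A * B * proj₂ A * B * proj₀ A) =
    (2 : ℂ) • (C * (proj₀ A * B * proj₀ A)) + (12 : ℂ) • (proj₀ A * B * proj₀ A) -
      (2 : ℂ) • (proj₀ A * B * proj₀ A * (proj₀ A * B * proj₀ A)) := by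
  have l : proj₀ A * A = 0 := by rw [proj₀_comm, mul_proj₀ h.char_A, zero_smul]
  have r : A * proj₀ A = 0 := by rw [mul_proj₀ h.char_A, zero_smul]
  have e : proj₀ A * B * A * B * proj₀ A = (2 : ℂ) • (proj₀ A * B * proj₂ A * B * proj₀ A) := by
    conv_lhs => enter [1, 1, 2]; rw [eq_proj A]
    rw [mul_add, mul_smul_comm, mul_smul_comm, h.proj₀_mul_mul_proj₆]
    simp
  have key : 2 * (proj₀ A * B * A * B * proj₀ A) = -2 * (proj₀ A * B * B * proj₀ A) +
      2 * (C * (proj₀ A * B * proj₀ A)) + 12 * (proj₀ A * B * proj₀ A) := by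
    linear_combination (norm := noncomm_ring) proj₀ A * h.rel_B * proj₀ A +
      l * B * B * proj₀ A + proj₀ A * B * B * r - 2 * l * B * proj₀ A - 2 * proj₀ A * B * r -
      2 * h.commute_A.proj₀.eq * B * proj₀ A
  rw [e, h.corner_square] at key
  simp only [ofNat_eq_smul_one (R := R), neg_mul, smul_mul_assoc, one_mul] at key
  linear_combination (norm := module) key

end IsRacahTriple

namespace IsRacahTriple
variable {R : Type*} [Ring R] [Algebra ℂ R] {A B C : R}

/-- Inserting p₀ + p₂ + p₆ = 1 around the middle `B` leaves the paths through p₀ and p₂ only, and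
the inner block p₂Bp₂ is already known. -/
theorem corner_cube (h : IsRacahTriple A B C) : proj₀ A * B * B * B * proj₀ A =
    proj₀ A * B * proj₀ A * (proj₀ A * B * proj₀ A) * (proj₀ A * B * proj₀ A) +
      proj₀ A * B * proj₀ A * (proj₀ A * B * proj₂ A * B * proj₀ A) +
      proj₀ A * B * proj₂ A * B * proj₀ A * (proj₀ A * B * proj₀ A) +
      (1 / 2 : ℂ) • (C * (proj₀ A * B * proj₂ A * B * proj₀ A)) +
      (2 : ℂ) • (proj₀ A * B * proj₂ A * B * proj₀ A) := by
  have left : proj₀ A * B = proj₀ A * B * proj₀ A + proj₀ A * B * proj₂ A := by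
    calc proj₀ A * B = proj₀ A * B * (proj₀ A + proj₂ A + proj₆ A) := by rw [proj_sum, mul_one]
      _ = _ := by rw [mul_add, mul_add, h.proj₀_mul_mul_proj₆, add_zero]
  have right : B * proj₀ A = proj₀ A * B * proj₀ A + proj₂ A * B * proj₀ A := by
    calc B * proj₀ A = (proj₀ A + proj₂ A + proj₆ A) * (B * proj₀ A) := by rw [proj_sum, one_mul]
      _ = _ := by
        rw [add_mul, add_mul, ← mul_assoc, ← mul_assoc, ← mul_assoc, h.proj₆_mul_mul_proj₀,
          add_zero]
  have i₀ := proj₀_idem h.char_A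
  have mid : proj₀ A * B * (proj₂ A * B * proj₂ A) * B * proj₀ A =
      (1 / 2 : ℂ) • (C * (proj₀ A * B * proj₂ A * B * proj₀ A)) +
      (2 : ℂ) • (proj₀ A * B * proj₂ A * B * proj₀ A) := by
    have c : Commute C (proj₀ A * B) := h.commute_A.proj₀.mul_right h.commute_B
    rw [h.proj₂_mul_mul_proj₂]
    simp only [mul_add, add_mul, mul_smul_comm, smul_mul_assoc, ← mul_assoc, c.eq]
  calc proj₀ A * B * B * B * proj₀ A = (proj₀ A * B * proj₀ A + proj₀ A * B * proj₂ A) * B *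
          (proj₀ A * B * proj₀ A + proj₂ A * B * proj₀ A) := by
        rw [← left, ← right]
        simp only [mul_assoc]
    _ = proj₀ A * B * proj₀ A * B * proj₀ A * B * proj₀ A +
        proj₀ A * B * proj₀ A * B * proj₂ A * B * proj₀ A +
        proj₀ A * B * proj₂ A * B * proj₀ A * B * proj₀ A +
        proj₀ A * B * (proj₂ A * B * proj₂ A) * B * proj₀ A := by
      noncomm_ring
    _ = _ := by
      rw [mid]
      have e (x y : R) : x * proj₀ A * (proj₀ A * y) = x * proj₀ A * y := by
        rw [mul_assoc, ← mul_assoc (proj₀ A), i₀, mul_assoc]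
      simp only [← mul_assoc] at e
      simp only [← mul_assoc, e, add_assoc]

/-- The cubic equation of `B`, compressed by p₀, involves only z and y = p₀Bp₂Bp₀; eliminating y by
`corner_linear` leaves a polynomial in z and `C`. -/
theorem corner_char (h : IsRacahTriple A B C) : let z := proj₀ A * B * proj₀ A
    z * (z + (C - 6) * proj₀ A) * (2 * z + C * proj₀ A) = 0 := by
  intro z
  have i₀ := proj₀_idem h.char_A
  have zp : z * proj₀ A = z := by simp only [z, mul_assoc, i₀]
  have cA := h.commute_A.proj₀
  have cz : Commute C z := (cA.mul_right h.commute_B).mul_right cA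
  have cube := h.corner_cube
  have sq := h.corner_square
  have lin := h.corner_linear
  set y := proj₀ A * B * proj₂ A * B * proj₀ A
  change _ = z * z * z + z * y + y * z + _ + _ at cube
  change _ = z * z + y at sq
  change _ = _ • (C * z) + _ • z - _ • (z * z) at lin
  have hy : y = (1 / 3 : ℂ) • (C * z) + (2 : ℂ) • z - (1 / 3 : ℂ) • (z * z) := by
    linear_combination (norm := module) (1 / 6 : ℂ) • lin
  have key : proj₀ A * B * B * B * proj₀ A =
      (8 : ℂ) • (proj₀ A * B * B * proj₀ A) - (12 : ℂ) • z := by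
    have := cube_eq_of_char h.char_B
    calc proj₀ A * B * B * B * proj₀ A = proj₀ A * (B * (B * B)) * proj₀ A := by
          simp only [mul_assoc]
      _ = _ := by
        rw [this]
        simp only [z, mul_sub, sub_mul, mul_smul_comm, smul_mul_assoc, mul_assoc]
  rw [cube, sq, hy] at key
  have r₁ (x : R) : z * (C * x) = C * (z * x) := (cz.left_comm x).symm
  have r₂ (x : R) : z * (proj₀ A * x) = z * x := by rw [← mul_assoc, zp]
  simp only [ofNat_eq_smul_one (R := R), mul_add, add_mul, mul_sub, sub_mul, mul_smul_comm,
    smul_mul_assoc, mul_one, one_mul, mul_assoc, r₁, r₂, zp, cz.eq.symm, cA.eq.symm] at key ⊢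
  linear_combination (norm := module) (6 : ℂ) • key

/-- This compresses by p₀ the fact that C = 0 cannot occur together with B = 6. It is what later
excludes C = 0 on p₀. -/
theorem corner_char_mul (h : IsRacahTriple A B C) : let z := proj₀ A * B * proj₀ A
    (C - 2) * (C - 6) * (C - 12) * (2 * z ^ 2 + C * z) = 0 := by
  intro z
  have cA := h.commute_A.proj₀
  have key := (h.commute_B.char_mul_of_char h.char_B h.char_C h.char_CB).2
  set Q := (C - 2) * (C - 6) * (C - 12)
  have cQ : Commute (proj₀ A) Q := by
    have (n : ℕ) [n.AtLeastTwo] : Commute (proj₀ A) (C - OfNat.ofNat n) :=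
      cA.symm.sub_right (Commute.ofNat_right _ n)
    exact ((this 2).mul_right (this 6)).mul_right (this 12)
  have e : Q * (proj₀ A * B * B * proj₀ A - 2 * z) = 0 := by
    change Q * (proj₀ A * B * B * proj₀ A - 2 * (proj₀ A * B * proj₀ A)) = 0
    linear_combination (norm := noncomm_ring) proj₀ A * key * proj₀ A
      - cQ.eq * B * B * proj₀ A + 2 * cQ.eq * B * proj₀ A
  rw [h.corner_square] at e
  have lin := h.corner_linear
  set y := proj₀ A * B * proj₂ A * B * proj₀ A
  change Q * (z * z + y - 2 * z) = 0 at e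
  change _ = _ • (C * z) + _ • z - _ • (z * z) at lin
  have hy : y = (1 / 3 : ℂ) • (C * z) + (2 : ℂ) • z - (1 / 3 : ℂ) • (z * z) := by
    linear_combination (norm := module) (1 / 6 : ℂ) • lin
  rw [hy] at e
  have e' : (2 * z ^ 2 + C * z) = (3 : ℂ) • (z * z +
      ((1 / 3 : ℂ) • (C * z) + (2 : ℂ) • z - (1 / 3 : ℂ) • (z * z)) - 2 * z) := by
    simp only [ofNat_eq_smul_one (R := R), smul_mul_assoc, one_mul, pow_two]
    module
  rw [e', mul_smul_comm, e, smul_zero]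

/-- The two corner equations are applied to `B` and, through `rotate`, to C - A - B + 6. As p₀A = 0,
the two corners add up to (C + 6)p₀, and this constraint leaves one solution. -/
theorem eigenvalue (h : IsRacahTriple A B C) : C * proj₀ A =
    2 * proj₀ A ∧ proj₀ A * B * proj₀ A = 4 * proj₀ A := by
  have i₀ := proj₀_idem h.char_A
  have cA := h.commute_A.proj₀
  have e : proj₀ A * (C - A - B + 6) * proj₀ A =
      C * proj₀ A + 6 * proj₀ A - proj₀ A * B * proj₀ A := by
    have hA : proj₀ A * A = 0 := by rw [proj₀_comm, mul_proj₀ h.char_A, zero_smul]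
    linear_combination (norm := noncomm_ring) - cA.eq * proj₀ A + C * i₀ + 6 * i₀ - hA * proj₀ A
  have h2 := h.rotate.corner_char
  have h4 := h.rotate.corner_char_mul
  simp only [e] at h2 h4
  exact cA.eigenvalue_of_char ((cA.mul_right h.commute_B).mul_right cA) i₀
    (by simp only [← mul_assoc, i₀]) (by simp only [mul_assoc, i₀])
    (by
      have := (h.commute_A.char_mul_of_char h.char_A h.char_C h.char_CA).1
      rw [proj₀, mul_smul_comm, this, smul_zero])
    h.corner_char h2 h.corner_char_mul h4

end IsRacahTriple

/-! ### Flip and contraction as polynomials in a Casimir -/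

section Projections
variable {R : Type*} [Ring R] [Algebra ℂ R]

/-- The Brauer generator `s` as a polynomial in an intermediate Casimir. -/
noncomputable def swapOf (X : R) : R := proj₀ X - proj₂ X + proj₆ X

/-- The Brauer generator `e` as a polynomial in an intermediate Casimir. -/
noncomputable def capOf (X : R) : R := (3 : ℂ) • proj₀ X

theorem swapOf_eq (X : R) : swapOf X = (1 / 4 : ℂ) • (X * X - (6 : ℂ) • X + (4 : ℂ) • 1) := by
  simp only [swapOf, proj₀, proj₂, proj₆, ofNat_eq_smul_one (R := R), mul_sub, sub_mul,
    smul_mul_assoc, mul_smul_comm, mul_one, one_mul, mul_assoc]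
  module

theorem proj₀_eq (X : R) :
    proj₀ X = (1 / 12 : ℂ) • (X * X - (8 : ℂ) • X + (12 : ℂ) • 1) := by
  simp only [proj₀, ofNat_eq_smul_one (R := R), mul_sub, sub_mul,
    smul_mul_assoc, mul_smul_comm, mul_one, one_mul, mul_assoc]
  module

theorem two_mul_swapOf_sub_capOf (X : R) : 2 * (swapOf X - capOf X) + 4 = X := by
  simp only [swapOf_eq, capOf, proj₀_eq, ofNat_eq_smul_one (R := R), smul_mul_assoc, one_mul]
  module

theorem swapOf_op (X : R) : swapOf (MulOpposite.op X) = MulOpposite.op (swapOf X) := by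
  simp [swapOf_eq]

theorem capOf_op (X : R) : capOf (MulOpposite.op X) = MulOpposite.op (capOf X) := by
  simp [capOf, proj₀_eq]

variable {X : R}

theorem swapOf_mul_proj₀ (hX : X * (X - 2) * (X - 6) = 0) : swapOf X * proj₀ X = proj₀ X := by
  have h := mul_proj₀ hX
  simp only [swapOf_eq, sub_mul, add_mul, smul_mul_assoc, mul_smul_comm, one_mul, mul_assoc, h]
  module

theorem swapOf_mul_self (hX : X * (X - 2) * (X - 6) = 0) : swapOf X * swapOf X = 1 := by
  have h := cube_eq_of_char hX
  simp only [swapOf_eq, sub_mul, add_mul, mul_sub, mul_add, smul_mul_assoc, mul_smul_comm,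
    one_mul, mul_one, mul_assoc, h]
  module

theorem swapOf_mul_capOf (hX : X * (X - 2) * (X - 6) = 0) : swapOf X * capOf X = capOf X := by
  rw [capOf, mul_smul_comm, swapOf_mul_proj₀ hX]

theorem capOf_mul_swapOf (hX : X * (X - 2) * (X - 6) = 0) : capOf X * swapOf X = capOf X := by
  have : Commute (capOf X) (swapOf X) := by
    have : Commute (capOf X) X := (((Commute.refl X).proj₀).smul_right (3 : ℂ)).symm
    exact (this.proj₀.sub_right this.proj₂).add_right this.proj₆
  rw [this.eq, swapOf_mul_capOf hX]

theorem capOf_mul_self (hX : X * (X - 2) * (X - 6) = 0) : capOf X * capOf X = (3 :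
    ℂ) • capOf X := by
  rw [capOf, smul_mul_smul_comm, proj₀_idem hX, smul_smul]

end Projections

/-! ### Brauer relations from Racah relations -/

namespace IsRacahTriple
variable {R : Type*} [Ring R] [Algebra ℂ R] {A B C : R}

/-- Conjugation by the flip of the factors 1 and 2 must take K₂₃ to K₁₃. As A - 2 = -2p₀ + 4p₆ has
no p₂ component, (A - 2)B(A - 2) involves only determined blocks; together with `rel_A` this gives
the identity. -/
theorem swapOf_mul (h : IsRacahTriple A B C) : swapOf A * B = (C - A - B + 6) * swapOf A := by
  have ev : C * proj₀ A = (2 : ℂ) • proj₀ A := by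
    rw [h.eigenvalue.1, ofNat_eq_smul_one (R := R), smul_mul_assoc, one_mul]
  have z : proj₀ A * B * proj₀ A = (4 : ℂ) • proj₀ A := by
    rw [h.eigenvalue.2, ofNat_eq_smul_one (R := R), smul_mul_assoc, one_mul]
  have hA : A - 2 = (-2 : ℂ) • proj₀ A + (4 : ℂ) • proj₆ A := by
    simp only [proj₀, proj₆, ofNat_eq_smul_one (R := R), mul_sub, sub_mul,
      smul_mul_assoc, mul_smul_comm, mul_one, one_mul, mul_assoc]
    module
  have key : (A - 2) * B * (A - 2) = (16 : ℂ) • proj₀ A + (8 : ℂ) • (C * proj₆ A) := by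
    rw [hA]
    simp only [add_mul, mul_add, smul_mul_assoc, mul_smul_comm, z, h.proj₀_mul_mul_proj₆,
      h.proj₆_mul_mul_proj₀, h.proj₆_mul_mul_proj₆]
    module
  have rel := h.rel_A
  have cube := cube_eq_of_char h.char_A
  simp only [proj₀_eq, proj₆, swapOf_eq, ofNat_eq_smul_one (R := R), mul_sub, sub_mul, mul_add,
    add_mul, smul_mul_assoc, mul_smul_comm, mul_one, one_mul, mul_assoc, pow_two, neg_mul,
    cube] at key ev rel ⊢
  linear_combination (norm := module) (-1 / 4 : ℂ) • rel + (1 / 2 : ℂ) • key - ev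

/-- Bp₀ = 4p₀ + p₂Bp₀, and `A` acts on the two terms by 0 and 2. -/
theorem mul_mul_proj₀ (h : IsRacahTriple A B C) : A * (B * proj₀ A) = (2 :
    ℂ) • (B * proj₀ A) - (8 : ℂ) • proj₀ A := by
  have z : proj₀ A * B * proj₀ A = (4 : ℂ) • proj₀ A := by
    rw [h.eigenvalue.2, ofNat_eq_smul_one (R := R), smul_mul_assoc, one_mul]
  have e : B * proj₀ A = (4 : ℂ) • proj₀ A + proj₂ A * B * proj₀ A := by
    calc B * proj₀ A = (proj₀ A + proj₂ A + proj₆ A) * (B * proj₀ A) := by rw [proj_sum, one_mul]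
      _ = _ := by
        rw [add_mul, add_mul, ← mul_assoc, ← mul_assoc, ← mul_assoc, h.proj₆_mul_mul_proj₀, z,
          add_zero]
  have e' : A * (B * proj₀ A) = (2 : ℂ) • (proj₂ A * B * proj₀ A) := by
    rw [e, mul_add, mul_smul_comm, mul_proj₀ h.char_A, ← mul_assoc, ← mul_assoc,
      mul_proj₂ h.char_A]
    simp
  linear_combination (norm := module) e' - (2 : ℂ) • e

theorem proj₀_mul_square_mul_proj₀ (h : IsRacahTriple A B C) : proj₀ A * B * B * proj₀ A =
    (64 / 3 : ℂ) • proj₀ A := by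
  have z : proj₀ A * B * proj₀ A = (4 : ℂ) • proj₀ A := by
    rw [h.eigenvalue.2, ofNat_eq_smul_one (R := R), smul_mul_assoc, one_mul]
  have ev : C * proj₀ A = (2 : ℂ) • proj₀ A := by
    rw [h.eigenvalue.1, ofNat_eq_smul_one (R := R), smul_mul_assoc, one_mul]
  have lin := h.corner_linear
  rw [h.corner_square]
  simp only [z, mul_smul_comm, smul_mul_assoc, proj₀_idem h.char_A, ev] at lin ⊢
  linear_combination (norm := module) (1 / 6 : ℂ) • lin

theorem capOf_mul_capOf_mul_capOf (h : IsRacahTriple A B C) : capOf A * capOf B * capOf A =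
    capOf A := by
  have z : proj₀ A * B * proj₀ A = (4 : ℂ) • proj₀ A := by
    rw [h.eigenvalue.2, ofNat_eq_smul_one (R := R), smul_mul_assoc, one_mul]
  have sq := h.proj₀_mul_square_mul_proj₀
  have i₀ := proj₀_idem h.char_A
  simp only [capOf, proj₀_eq B, mul_sub, mul_add, sub_mul, add_mul, mul_smul_comm, smul_mul_assoc,
    mul_one, ← mul_assoc, z, sq, i₀]
  module

/-- Both sides are polynomials in `B` applied to p₀, so it suffices to move the flip past Bp₀ and
B²p₀, which `swapOf_mul` and C = 2 on p₀ make explicit. -/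
theorem swapOf_mul_capOf_mul_capOf (h : IsRacahTriple A B C) : swapOf A * capOf B * capOf A =
    swapOf B * capOf A := by
  have ev : C * proj₀ A = (2 : ℂ) • proj₀ A := by
    rw [h.eigenvalue.1, ofNat_eq_smul_one (R := R), smul_mul_assoc, one_mul]
  have s := swapOf_mul_proj₀ h.char_A
  have hD : (C - A - B + 6) * proj₀ A = (8 : ℂ) • proj₀ A - B * proj₀ A := by
    simp only [sub_mul, add_mul, ev, mul_proj₀ h.char_A, ofNat_eq_smul_one (R := R),
      smul_mul_assoc, one_mul]
    module
  have t₁ : swapOf A * (B * proj₀ A) = (8 : ℂ) • proj₀ A - B * proj₀ A := by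
    rw [← mul_assoc, h.swapOf_mul, mul_assoc, s, hD]
  have hDB : (C - A - B + 6) * (B * proj₀ A) =
      (6 : ℂ) • (B * proj₀ A) + (8 : ℂ) • proj₀ A - B * (B * proj₀ A) := by
    have : C * (B * proj₀ A) = (2 : ℂ) • (B * proj₀ A) := by
      rw [h.commute_B.left_comm, ev, mul_smul_comm]
    simp only [sub_mul, add_mul, this, h.mul_mul_proj₀, ofNat_eq_smul_one (R := R),
      smul_mul_assoc, one_mul]
    module
  have t₂ : swapOf A * (B * (B * proj₀ A)) =
      (64 : ℂ) • proj₀ A - (8 : ℂ) • (B * proj₀ A) -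
        ((6 : ℂ) • (B * proj₀ A) + (8 : ℂ) • proj₀ A - B * (B * proj₀ A)) := by
    rw [← mul_assoc, h.swapOf_mul, mul_assoc, t₁, mul_sub, mul_smul_comm, hD, hDB]
    module
  simp only [capOf, proj₀_eq B, swapOf_eq B, mul_sub, mul_add, sub_mul, add_mul, mul_smul_comm,
    smul_mul_assoc, mul_one, one_mul, mul_assoc, s, t₁, t₂]
  module

theorem capOf_mul_capOf_mul_swapOf (h : IsRacahTriple A B C) : capOf B * capOf A * swapOf B =
    capOf B * swapOf A := by
  have := congrArg MulOpposite.unop h.symm.op.swapOf_mul_capOf_mul_capOf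
  simpa only [swapOf_op, capOf_op, MulOpposite.unop_mul, MulOpposite.unop_op, mul_assoc] using this

theorem swapOf_mul_mul_swapOf (h : IsRacahTriple A B C) : swapOf A * B * swapOf A =
    C - A - B + 6 := by
  rw [h.swapOf_mul, mul_assoc, swapOf_mul_self h.char_A, mul_one]

theorem swapOf_mul_swapOf_mul_swapOf_eq (h : IsRacahTriple A B C) :
    swapOf A * swapOf B * swapOf A = swapOf (C - A - B + 6) := by
  have s := swapOf_mul_self h.char_A
  have t := h.swapOf_mul_mul_swapOf
  have t₂ : swapOf A * B * B * swapOf A = (C - A - B + 6) * (C - A - B + 6) := by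
    rw [h.swapOf_mul, mul_assoc _ _ B, h.swapOf_mul, mul_assoc, mul_assoc, s, mul_one]
  rw [swapOf_eq B, swapOf_eq (C - A - B + 6)]
  simp only [mul_sub, mul_add, sub_mul, add_mul, mul_smul_comm, smul_mul_assoc, mul_one,
    ← mul_assoc, s]
  simp only [t₂, t]
  simp only [mul_sub, mul_add, sub_mul, add_mul, ← mul_assoc]

/-- Both sides are the flip attached to C - A - B + 6, an expression symmetric in `A` and `B`. -/
theorem braid (h : IsRacahTriple A B C) : swapOf A * swapOf B * swapOf A =
    swapOf B * swapOf A * swapOf B := by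
  rw [h.swapOf_mul_swapOf_mul_swapOf_eq, h.symm.swapOf_mul_swapOf_mul_swapOf_eq,
    sub_right_comm C B A]

end IsRacahTriple

/-! ### The relations at spins 1, 1, 1 and the universal property -/

theorem cas_two : cas 2 = 2 := by norm_num [cas]

theorem casValues_coupling : casValues (coupling 2 2) = {0, 2, 6} := by
  have : coupling 2 2 = {0, 2, 4} := by decide
  simp only [casValues, this, Finset.image_insert, Finset.image_singleton, cas]
  norm_num

theorem bratteliEdges_two :
    bratteliEdges 2 2 2 = {(0, 2), (2, 0), (2, 2), (2, 4), (4, 2), (4, 4), (4, 6)} := by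
  decide

theorem casValues_coupling₃ : casValues (coupling₃ 2 2 2) = {0, 2, 6, 12} := by
  have : coupling₃ 2 2 2 = {0, 2, 4, 6} := by decide
  simp only [casValues, this, Finset.image_insert, Finset.image_singleton, cas]
  norm_num

theorem edgeValues_two : edgeValues 2 2 2 = {-4, -2, 0, 2, 4, 6} := by
  simp only [edgeValues, bratteliEdges_two, Finset.image_insert, Finset.image_singleton, cas]
  norm_num
  ext x
  simp only [Finset.mem_insert, Finset.mem_singleton]
  tauto

section RootProd
variable {R : Type} [Ring R] [Algebra ℂ R]

theorem rootProd_cubic (x : R) : rootProd {0, 2, 6} x = x * (x - 2) * (x - 6) := by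
  simp [rootProd, Finset.prod_insert, mul_assoc, map_ofNat (algebraMap ℂ R)]

theorem rootProd_quartic (x : R) :
    rootProd {0, 2, 6, 12} x = x * (x - 2) * (x - 6) * (x - 12) := by
  simp [rootProd, Finset.prod_insert, mul_assoc, map_ofNat (algebraMap ℂ R)]

theorem rootProd_sextic (x : R) : rootProd {-4, -2, 0, 2, 4, 6} x =
    (x + 4) * (x + 2) * x * (x - 2) * (x - 4) * (x - 6) := by
  rw [rootProd]
  repeat rw [Finset.prod_insert (by norm_num)]
  simp [mul_assoc, map_ofNat (algebraMap ℂ R)]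

theorem map_rootProd {S : Type} [Ring S] [Algebra ℂ S] (f : R →ₐ[ℂ] S) (T : Finset ℚ) (x : R) :
    f (rootProd T x) = rootProd T (f x) := by
  rw [rootProd, rootProd, Polynomial.aeval_algHom_apply]

end RootProd

section Hom
variable {S : Type} [Ring S] [Algebra ℂ S] (π : RacahAlgebra →ₐ[ℂ] S)

theorem map_racahGen_α (hπ : ∀ ⦃x y⦄, QuotientRel 2 2 2 x y → π x = π y) (i : Fin 3) :
    π (racahGen (.α i)) = 2 := by
  have key {x : RacahAlgebra} (hx : QuotientRel 2 2 2 x (algebraMap ℂ _ (cas 2 : ℂ))) :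
      π x = 2 := by
    rw [hπ hx, cas_two, AlgHom.commutes]
    simp [map_ofNat (algebraMap ℂ S)]
  fin_cases i
  · exact key .alpha₁
  · exact key .alpha₂
  · exact key .alpha₃

/-- Stated for every map respecting the relations, so that it serves both the quotient itself and
the homomorphisms out of it. -/
theorem isRacahTriple_map_racahGen (hπ : ∀ ⦃x y⦄, QuotientRel 2 2 2 x y → π x = π y) :
    IsRacahTriple (π (racahGen .A)) (π (racahGen .B)) (π (racahGen .C)) := by
  have hr {x y : FreeAlgebra ℂ RacahGen} (h : RacahRel x y) :
      π (RingQuot.mkAlgHom ℂ RacahRel x) = π (RingQuot.mkAlgHom ℂ RacahRel y) := by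
    rw [RingQuot.mkAlgHom_rel ℂ h]
  have hg (g : RacahGen) : RingQuot.mkAlgHom ℂ RacahRel (freeGen g) = racahGen g := rfl
  have e : (2 : S) + 2 + 2 = 6 := by norm_num
  have hα := map_racahGen_α π hπ
  constructor
  · simpa only [map_mul, hg] using hr (.central_C .A)
  · simpa only [map_mul, hg] using hr (.central_C .B)
  · have := hr .racah_A
    simp only [map_mul, map_add, map_sub, map_neg, map_pow, map_ofNat, Ring.lie_def, hg,
      hα] at this
    linear_combination (norm := noncomm_ring) this
  · have := hr .racah_B
    simp only [map_mul, map_add, map_sub, map_neg, map_pow, map_ofNat, Ring.lie_def, hg,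
      hα] at this
    linear_combination (norm := noncomm_ring) this
  · have := hπ .char_A
    rwa [map_rootProd, casValues_coupling, rootProd_cubic, map_zero] at this
  · have := hπ .char_B
    rwa [map_rootProd, casValues_coupling, rootProd_cubic, map_zero] at this
  · have := hπ .char_CAB
    rw [map_rootProd, casValues_coupling, rootProd_cubic, map_zero] at this
    simpa only [map_sub, map_add, hα, e] using this
  · have := hπ .char_C
    rwa [map_rootProd, casValues_coupling₃, rootProd_quartic, map_zero] at this
  · have := hπ .char_CA
    rwa [map_rootProd, edgeValues_two, rootProd_sextic, map_zero, map_sub] at this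
  · have := hπ .char_CB
    rwa [map_rootProd, edgeValues_two, rootProd_sextic, map_zero, map_sub] at this
  · have := hπ .char_AB
    rw [map_rootProd, edgeValues_two, rootProd_sextic, map_zero] at this
    simpa only [map_sub, map_add, hα, e] using this

/-- Solving the conjugation formula for `C` writes it as a polynomial in `A` and `B`. Hence these
two generate the quotient and determine every homomorphism from it. -/
theorem map_racahGen_C (hπ : ∀ ⦃x y⦄, QuotientRel 2 2 2 x y → π x = π y) : π (racahGen .C) =
    swapOf (π (racahGen .A)) * π (racahGen .B) *
    swapOf (π (racahGen .A)) + π (racahGen .A) + π (racahGen .B) - 6 := by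
  rw [(isRacahTriple_map_racahGen π hπ).swapOf_mul_mul_swapOf]
  abel

end Hom

theorem isRacahTriple_quotGen :
    IsRacahTriple (quotGen 2 2 2 .A) (quotGen 2 2 2 .B) (quotGen 2 2 2 .C) :=
  isRacahTriple_map_racahGen (S := QuotientRacah 2 2 2)
    (RingQuot.mkAlgHom ℂ (QuotientRel 2 2 2)) fun _ _ h => RingQuot.mkAlgHom_rel ℂ h

namespace IsRacahTriple
variable {R : Type} [Ring R] [Algebra ℂ R] {A B C : R}

/-- The images of the generators of the universal Racah algebra under the specialization at a
triple with `α₁ = α₂ = α₃ = 2`. -/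
def genMap (A B C : R) : RacahGen → R
  | .A => A
  | .B => B
  | .C => C
  | .α _ => 2

theorem exists_lift (h : IsRacahTriple A B C) : ∃ f : QuotientRacah 2 2 2 →ₐ[ℂ] R,
    f (quotGen 2 2 2 .A) = A ∧ f (quotGen 2 2 2 .B) = B ∧ f (quotGen 2 2 2 .C) = C := by
  let f₀ : FreeAlgebra ℂ RacahGen →ₐ[ℂ] R := FreeAlgebra.lift ℂ (genMap A B C)
  have h₀ (g : RacahGen) : f₀ (freeGen g) = genMap A B C g := FreeAlgebra.lift_ι_apply _ _
  have hrel ⦃x y : FreeAlgebra ℂ RacahGen⦄ (hxy : RacahRel x y) : f₀ x = f₀ y := by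
    cases hxy with
    | central_C g =>
      simp only [map_mul, h₀]
      cases g with
      | A => exact h.comm_A
      | B => exact h.comm_B
      | C => rfl
      | α i => exact (Commute.ofNat_right C 2).eq
    | central_α i g =>
      simp only [map_mul, h₀]
      exact (Commute.ofNat_left 2 _).eq
    | racah_B =>
      simp only [map_mul, map_add, map_sub, map_neg, map_pow, map_ofNat, Ring.lie_def, h₀, genMap]
      linear_combination (norm := noncomm_ring) h.rel_B
    | racah_A =>
      simp only [map_mul, map_add, map_sub, map_neg, map_pow, map_ofNat, Ring.lie_def, h₀, genMap]
      linear_combination (norm := noncomm_ring) h.rel_A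
  let f₁ : RacahAlgebra →ₐ[ℂ] R := RingQuot.liftAlgHom ℂ ⟨f₀, hrel⟩
  have h₁ (g : RacahGen) : f₁ (racahGen g) = genMap A B C g := by
    rw [← h₀]
    exact RingQuot.liftAlgHom_mkAlgHom_apply _ _ _ _
  have two : algebraMap ℂ R (cas 2 : ℂ) = 2 := by simp [cas_two, map_ofNat (algebraMap ℂ R)]
  have e : (2 : R) + 2 + 2 = 6 := by norm_num
  have hrel₁ ⦃x y : RacahAlgebra⦄ (hxy : QuotientRel 2 2 2 x y) : f₁ x = f₁ y := by
    cases hxy with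
    | alpha₁ => rw [h₁, AlgHom.commutes, two]; rfl
    | alpha₂ => rw [h₁, AlgHom.commutes, two]; rfl
    | alpha₃ => rw [h₁, AlgHom.commutes, two]; rfl
    | char_A | char_B =>
      rw [map_rootProd, h₁, casValues_coupling, rootProd_cubic, map_zero]
      first | exact h.char_A | exact h.char_B
    | char_C => rw [map_rootProd, h₁, casValues_coupling₃, rootProd_quartic,
      map_zero]; exact h.char_C
    | char_CAB =>
      simp only [map_rootProd, map_sub, map_add, map_zero, h₁, genMap, e]
      rw [casValues_coupling, rootProd_cubic, h.char_D]
    | char_AB =>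
      simp only [map_rootProd, map_sub, map_add, map_zero, h₁, genMap, e]
      rw [edgeValues_two, rootProd_sextic, h.char_CD]
    | char_CA =>
      rw [map_rootProd, map_sub, h₁, h₁, edgeValues_two, rootProd_sextic, map_zero]
      exact h.char_CA
    | char_CB =>
      rw [map_rootProd, map_sub, h₁, h₁, edgeValues_two, rootProd_sextic, map_zero]
      exact h.char_CB
  have h₂ (g : RacahGen) : RingQuot.liftAlgHom ℂ ⟨f₁, hrel₁⟩ (quotGen 2 2 2 g) =
      genMap A B C g := by
    rw [← h₁]
    exact RingQuot.liftAlgHom_mkAlgHom_apply _ _ _ _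
  exact ⟨RingQuot.liftAlgHom ℂ ⟨f₁, hrel₁⟩, h₂ .A, h₂ .B, h₂ .C⟩

end IsRacahTriple

theorem quotientRacah_hom_ext {R : Type} [Ring R] [Algebra ℂ R]
    {f g : QuotientRacah 2 2 2 →ₐ[ℂ] R} (hA : f (quotGen 2 2 2 .A) = g (quotGen 2 2 2 .A))
    (hB : f (quotGen 2 2 2 .B) = g (quotGen 2 2 2 .B)) : f = g := by
  let π (f : QuotientRacah 2 2 2 →ₐ[ℂ] R) : RacahAlgebra →ₐ[ℂ] R :=
    f.comp (RingQuot.mkAlgHom ℂ (QuotientRel 2 2 2))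
  have hπ (f : QuotientRacah 2 2 2 →ₐ[ℂ] R) ⦃x y⦄ (h : QuotientRel 2 2 2 x y) :
      π f x = π f y := congrArg f (RingQuot.mkAlgHom_rel ℂ h)
  change π f (racahGen .A) = π g (racahGen .A) at hA
  change π f (racahGen .B) = π g (racahGen .B) at hB
  refine RingQuot.ringQuot_ext' _ _ _ (RingQuot.ringQuot_ext' _ _ _ (FreeAlgebra.hom_ext ?_))
  funext x
  change π f (racahGen x) = π g (racahGen x)
  cases x with
  | A => exact hA
  | B => exact hB
  | C => rw [map_racahGen_C _ (hπ f), map_racahGen_C _ (hπ g), hA, hB]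
  | α i => rw [map_racahGen_α _ (hπ f), map_racahGen_α _ (hπ g)]

/-! ### Racah relations from Brauer relations -/

/-- Elements `s₁, s₂, e₁, e₂` of a complex algebra satisfying the relations of `B₃(3)`. -/
structure IsBrauerQuadruple {R : Type*} [Ring R] [Algebra ℂ R] (s₁ s₂ e₁ e₂ : R) : Prop where
  s₁_sq : s₁ * s₁ = 1
  s₂_sq : s₂ * s₂ = 1
  e₁_sq : e₁ * e₁ = (3 : ℂ) • e₁
  e₂_sq : e₂ * e₂ = (3 : ℂ) • e₂
  s₁_e₁ : s₁ * e₁ = e₁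
  e₁_s₁ : e₁ * s₁ = e₁
  s₂_e₂ : s₂ * e₂ = e₂
  e₂_s₂ : e₂ * s₂ = e₂
  braid : s₁ * s₂ * s₁ = s₂ * s₁ * s₂
  e₁_e₂_e₁ : e₁ * e₂ * e₁ = e₁
  e₂_e₁_e₂ : e₂ * e₁ * e₂ = e₂
  s₁_e₂_e₁ : s₁ * e₂ * e₁ = s₂ * e₁
  e₂_e₁_s₂ : e₂ * e₁ * s₂ = e₂ * s₁

namespace IsBrauerQuadruple
variable {R : Type*} [Ring R] [Algebra ℂ R] {s₁ s₂ e₁ e₂ : R}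

theorem s₂_e₁_e₂ (h : IsBrauerQuadruple s₁ s₂ e₁ e₂) : s₂ * e₁ * e₂ = s₁ * e₂ := by
  rw [← h.s₁_e₂_e₁, mul_assoc, mul_assoc, ← mul_assoc e₂, h.e₂_e₁_e₂]

theorem e₁_e₂_s₁ (h : IsBrauerQuadruple s₁ s₂ e₁ e₂) : e₁ * e₂ * s₁ = e₁ * s₂ := by
  rw [mul_assoc, ← h.e₂_e₁_s₂, ← mul_assoc, ← mul_assoc, h.e₁_e₂_e₁]

theorem symm (h : IsBrauerQuadruple s₁ s₂ e₁ e₂) : IsBrauerQuadruple s₂ s₁ e₂ e₁ :=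
  ⟨h.s₂_sq, h.s₁_sq, h.e₂_sq, h.e₁_sq, h.s₂_e₂, h.e₂_s₂, h.s₁_e₁, h.e₁_s₁, h.braid.symm,
    h.e₂_e₁_e₂, h.e₁_e₂_e₁, h.s₂_e₁_e₂, h.e₁_e₂_s₁⟩

theorem s₁_s₂_e₁ (h : IsBrauerQuadruple s₁ s₂ e₁ e₂) : s₁ * s₂ * e₁ = e₂ * e₁ := by
  rw [mul_assoc, ← h.s₁_e₂_e₁, mul_assoc s₁, ← mul_assoc, h.s₁_sq, one_mul]

theorem e₂_s₁_s₂ (h : IsBrauerQuadruple s₁ s₂ e₁ e₂) : e₂ * s₁ * s₂ = e₂ * e₁ := by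
  rw [← h.e₂_e₁_s₂, mul_assoc, h.s₂_sq, mul_one]

theorem e₁_s₂_e₁ (h : IsBrauerQuadruple s₁ s₂ e₁ e₂) : e₁ * s₂ * e₁ = e₁ := by
  rw [mul_assoc, ← h.s₁_e₂_e₁, ← mul_assoc, ← mul_assoc, h.e₁_s₁, h.e₁_e₂_e₁]

theorem s₂_e₁_s₂ (h : IsBrauerQuadruple s₁ s₂ e₁ e₂) : s₂ * e₁ * s₂ = s₁ * e₂ * s₁ := by
  rw [← h.s₁_e₂_e₁, mul_assoc, mul_assoc, ← mul_assoc e₂, h.e₂_e₁_s₂, mul_assoc]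

/-- Left multiplication by the generators on the fifteen normal words. -/
theorem rules_one (h : IsBrauerQuadruple s₁ s₂ e₁ e₂) :
    s₁ * s₁ = 1 ∧ (∀ x, s₁ * (s₁ * x) = x) ∧ e₁ * e₁ = (3 : ℂ) • e₁ ∧
    (∀ x, e₁ * (e₁ * x) = (3 : ℂ) • (e₁ * x)) ∧ s₁ * e₁ = e₁ ∧ (∀ x, s₁ * (e₁ * x) = e₁ * x) ∧
    e₁ * s₁ = e₁ ∧ (∀ x, e₁ * (s₁ * x) = e₁ * x) := by
  refine ⟨h.s₁_sq, fun x => ?_, h.e₁_sq, fun x => ?_, h.s₁_e₁, fun x => ?_, h.e₁_s₁, fun x => ?_⟩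
  · rw [← mul_assoc, h.s₁_sq, one_mul]
  · rw [← mul_assoc, h.e₁_sq, smul_mul_assoc]
  · rw [← mul_assoc, h.s₁_e₁]
  · rw [← mul_assoc, h.e₁_s₁]

/-- Rewriting rules for right-associated words; each occurs a second time with a tail `x`, so that
it also fires inside a longer word. -/
theorem rules_mixed (h : IsBrauerQuadruple s₁ s₂ e₁ e₂) :
    e₁ * (e₂ * e₁) = e₁ ∧ (∀ x, e₁ * (e₂ * (e₁ * x)) = e₁ * x) ∧
    s₁ * (e₂ * e₁) = s₂ * e₁ ∧ (∀ x, s₁ * (e₂ * (e₁ * x)) = s₂ * (e₁ * x)) ∧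
    e₂ * (e₁ * s₂) = e₂ * s₁ ∧ (∀ x, e₂ * (e₁ * (s₂ * x)) = e₂ * (s₁ * x)) ∧
    s₁ * (s₂ * e₁) = e₂ * e₁ ∧ (∀ x, s₁ * (s₂ * (e₁ * x)) = e₂ * (e₁ * x)) ∧
    e₂ * (s₁ * s₂) = e₂ * e₁ ∧ (∀ x, e₂ * (s₁ * (s₂ * x)) = e₂ * (e₁ * x)) ∧
    e₁ * (s₂ * e₁) = e₁ ∧ (∀ x, e₁ * (s₂ * (e₁ * x)) = e₁ * x) := by
  refine ⟨?_, fun x => ?_, ?_, fun x => ?_, ?_, fun x => ?_, ?_, fun x => ?_, ?_, fun x => ?_,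
    ?_, fun x => ?_⟩
  · rw [← mul_assoc, h.e₁_e₂_e₁]
  · rw [← mul_assoc, ← mul_assoc, h.e₁_e₂_e₁]
  · rw [← mul_assoc, h.s₁_e₂_e₁]
  · rw [← mul_assoc, ← mul_assoc, h.s₁_e₂_e₁, mul_assoc]
  · rw [← mul_assoc, h.e₂_e₁_s₂]
  · rw [← mul_assoc, ← mul_assoc, h.e₂_e₁_s₂, mul_assoc]
  · rw [← mul_assoc, h.s₁_s₂_e₁]
  · rw [← mul_assoc, ← mul_assoc, h.s₁_s₂_e₁, mul_assoc]
  · rw [← mul_assoc, h.e₂_s₁_s₂]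
  · rw [← mul_assoc, ← mul_assoc, h.e₂_s₁_s₂, mul_assoc]
  · rw [← mul_assoc, h.e₁_s₂_e₁]
  · rw [← mul_assoc, ← mul_assoc, h.e₁_s₂_e₁]

/-- Used in this orientation only, without the mirror image: the normal forms chosen are s₁s₂s₁ and
s₁e₂s₁, and the mirrored rules would loop. -/
theorem rules_conj (h : IsBrauerQuadruple s₁ s₂ e₁ e₂) :
    s₂ * (s₁ * s₂) = s₁ * (s₂ * s₁) ∧ (∀ x, s₂ * (s₁ * (s₂ * x)) = s₁ * (s₂ * (s₁ * x))) ∧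
    s₂ * (e₁ * s₂) = s₁ * (e₂ * s₁) ∧ (∀ x, s₂ * (e₁ * (s₂ * x)) = s₁ * (e₂ * (s₁ * x))) := by
  refine ⟨?_, fun x => ?_, ?_, fun x => ?_⟩
  · rw [← mul_assoc, ← mul_assoc, h.braid]
  · rw [← mul_assoc, ← mul_assoc, ← h.braid]
    simp only [mul_assoc]
  · rw [← mul_assoc, ← mul_assoc, h.s₂_e₁_s₂]
  · rw [← mul_assoc, ← mul_assoc, h.s₂_e₁_s₂]
    simp only [mul_assoc]

theorem char_two_mul_add_four (h : IsBrauerQuadruple s₁ s₂ e₁ e₂) :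
    (2 * (s₁ - e₁) + 4) * (2 * (s₁ - e₁) + 4 - 2) *
    (2 * (s₁ - e₁) + 4 - 6) = 0 := by
  simp only [ofNat_eq_smul_one (R := R), mul_sub, sub_mul, mul_add, add_mul, smul_mul_assoc,
    mul_smul_comm, mul_one, one_mul, mul_assoc, h.rules_one, smul_sub, smul_add]
  module

/-- As a polynomial in u, the product has the roots -3, …, 2, symmetric under u ↦ -1 - u. It is
therefore 64v(v - 2)(v - 6) with v = u² + u, and only powers of v up to the third have to be
reduced. -/
theorem sextic (h : IsBrauerQuadruple s₁ s₂ e₁ e₂) :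
    (2 * (s₂ - e₂ + (s₁ * s₂ * s₁ - s₁ * e₂ * s₁)) + 2 + 4) *
    (2 * (s₂ - e₂ + (s₁ * s₂ * s₁ - s₁ * e₂ * s₁)) + 2 + 2) *
    (2 * (s₂ - e₂ + (s₁ * s₂ * s₁ - s₁ * e₂ * s₁)) + 2) *
    (2 * (s₂ - e₂ + (s₁ * s₂ * s₁ - s₁ * e₂ * s₁)) + 2 - 2) *
    (2 * (s₂ - e₂ + (s₁ * s₂ * s₁ - s₁ * e₂ * s₁)) + 2 - 4) *
    (2 * (s₂ - e₂ + (s₁ * s₂ * s₁ - s₁ * e₂ * s₁)) + 2 - 6) = 0 := by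
  have hv : (s₂ - e₂ + (s₁ * s₂ * s₁ - s₁ * e₂ * s₁)) *
      (s₂ - e₂ + (s₁ * s₂ * s₁ - s₁ * e₂ * s₁)) + (s₂ - e₂ + (s₁ * s₂ * s₁ - s₁ * e₂ * s₁)) =
      (2 : ℂ) • 1 + s₂ + s₁ * s₂ + s₂ * s₁ + s₁ * e₂ + e₂ * s₁ - s₂ * e₁ - e₁ * s₂ - e₁ * e₂ -
        e₂ * e₁ + s₁ * (s₂ * s₁) := by
    simp only [mul_sub, sub_mul, mul_add, add_mul, smul_mul_assoc, mul_smul_comm, mul_assoc,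
      mul_one, h.rules_one, h.symm.rules_one, h.rules_mixed, h.symm.rules_mixed, h.rules_conj]
    module
  generalize s₂ - e₂ + (s₁ * s₂ * s₁ - s₁ * e₂ * s₁) = u at hv ⊢
  have hv₂ : (u * u + u) * (u * u + u) = (8 : ℂ) • 1 + (4 : ℂ) • s₁ + (6 : ℂ) • s₂ +
      (2 : ℂ) • e₂ + (6 : ℂ) • (s₁ * s₂) + (6 : ℂ) • (s₂ * s₁) + (4 : ℂ) • (s₁ * e₂) +
      (4 : ℂ) • (e₂ * s₁) - (6 : ℂ) • (s₂ * e₁) - (6 : ℂ) • (e₁ * s₂) - (6 : ℂ) • (e₁ * e₂) -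
      (6 : ℂ) • (e₂ * e₁) + (6 : ℂ) • (s₁ * (s₂ * s₁)) + (2 : ℂ) • (s₁ * (e₂ * s₁)) := by
    rw [hv]
    simp only [mul_sub, sub_mul, mul_add, add_mul, smul_mul_assoc,
      mul_smul_comm, mul_one, one_mul, mul_assoc, h.rules_one,
      h.symm.rules_one, h.rules_mixed, h.symm.rules_mixed, h.rules_conj]
    module
  have hv₃ : (u * u + u) * (u * u + u) * (u * u + u) =
      8 * ((u * u + u) * (u * u + u)) - 12 * (u * u + u) := by
    rw [hv₂, hv]
    simp only [ofNat_eq_smul_one (R := R), mul_sub, sub_mul, mul_add, add_mul, smul_mul_assoc,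
      mul_smul_comm, mul_one, one_mul, mul_assoc, h.rules_one,
      h.symm.rules_one, h.rules_mixed, h.symm.rules_mixed, h.rules_conj, smul_sub, smul_add]
    module
  have e : (2 * u + 2 + 4) * (2 * u + 2 + 2) * (2 * u + 2) * (2 * u + 2 - 2) * (2 * u + 2 - 4) *
      (2 * u + 2 - 6) = 64 * ((u * u + u) * (u * u + u) * (u * u + u) -
      8 * ((u * u + u) * (u * u + u)) + 12 * (u * u + u)) := by
    simp only [ofNat_eq_smul_one (R := R), mul_sub, sub_mul, mul_add, add_mul, smul_mul_assoc,
      mul_smul_comm, mul_one, one_mul, mul_assoc, smul_sub, smul_add]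
    module
  rw [e, hv₃]
  noncomm_ring

theorem conj_mul_conj (h : IsBrauerQuadruple s₁ s₂ e₁ e₂) (x y : R) :
    s₁ * x * s₁ * (s₁ * y * s₁) = s₁ * (x * y) * s₁ := by
  simp only [mul_assoc, h.rules_one]

theorem conj_sub_ofNat (h : IsBrauerQuadruple s₁ s₂ e₁ e₂) (x : R) (n : ℕ) [n.AtLeastTwo] :
    s₁ * x * s₁ - OfNat.ofNat n = s₁ * (x - OfNat.ofNat n) * s₁ := by
  rw [mul_sub, sub_mul, (Commute.ofNat_right s₁ n).eq, mul_assoc (OfNat.ofNat n), h.s₁_sq, mul_one]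

theorem conj_add_ofNat (h : IsBrauerQuadruple s₁ s₂ e₁ e₂) (x : R) (n : ℕ) [n.AtLeastTwo] :
    s₁ * x * s₁ + OfNat.ofNat n = s₁ * (x + OfNat.ofNat n) * s₁ := by
  rw [mul_add, add_mul, (Commute.ofNat_right s₁ n).eq, mul_assoc (OfNat.ofNat n), h.s₁_sq, mul_one]

theorem quartic (h : IsBrauerQuadruple s₁ s₂ e₁ e₂) {C : R} (hC : C =
    2 * (s₁ - e₁ + (s₂ - e₂) + (s₁ * s₂ * s₁ - s₁ * e₂ * s₁)) + 6) :
    C * (C - 2) * (C - 6) * (C - 12) = 0 := by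
  have hc : (s₁ - e₁ + (s₂ - e₂) + (s₁ * s₂ * s₁ - s₁ * e₂ * s₁)) *
      (s₁ - e₁ + (s₂ - e₂) + (s₁ * s₂ * s₁ - s₁ * e₂ * s₁)) =
      (3 : ℂ) • 1 + e₁ + (3 : ℂ) • (s₁ * s₂) - s₁ * e₂ + (3 : ℂ) • (s₂ * s₁) - e₂ * s₁ -
        e₁ * s₂ - e₁ * e₂ - s₂ * e₁ + e₂ - e₂ * e₁ + s₁ * (e₂ * s₁) := by
    simp only [mul_sub, sub_mul, mul_add, add_mul, smul_mul_assoc, mul_smul_comm, mul_assoc,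
      mul_one, h.rules_one, h.symm.rules_one, h.rules_mixed, h.symm.rules_mixed, h.rules_conj]
    module
  set c := s₁ - e₁ + (s₂ - e₂) + (s₁ * s₂ * s₁ - s₁ * e₂ * s₁) with hc'
  have e : C * (C - 2) * (C - 6) * (C - 12) = 16 * ((c * c - 9) * (c * c + 2 * c)) := by
    rw [hC]
    simp only [ofNat_eq_smul_one (R := R), mul_sub, sub_mul, mul_add, add_mul, smul_mul_assoc,
      mul_smul_comm, mul_one, one_mul, mul_assoc, smul_sub, smul_add]
    module
  have z : (c * c - 9) * (c * c + 2 * c) = 0 := by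
    rw [hc, hc']
    simp only [ofNat_eq_smul_one (R := R), mul_sub, sub_mul, mul_add, add_mul, smul_mul_assoc,
      mul_smul_comm, mul_one, one_mul, mul_assoc, h.rules_one,
      h.symm.rules_one, h.rules_mixed, h.symm.rules_mixed, h.rules_conj, smul_sub, smul_add]
    module
  rw [e, z, mul_zero]

theorem isRacahTriple (h : IsBrauerQuadruple s₁ s₂ e₁ e₂) :
    IsRacahTriple (2 * (s₁ - e₁) + 4) (2 * (s₂ - e₂) + 4)
    (2 * (s₁ - e₁ + (s₂ - e₂) + (s₁ * s₂ * s₁ - s₁ * e₂ * s₁)) + 6) where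
  comm_A := by
    simp only [ofNat_eq_smul_one (R := R), mul_sub, sub_mul, mul_add, add_mul, smul_mul_assoc,
      mul_smul_comm, mul_one, one_mul, mul_assoc, h.rules_one,
      h.symm.rules_one, h.rules_mixed, h.symm.rules_mixed, h.rules_conj, smul_sub, smul_add]
    module
  comm_B := by
    simp only [ofNat_eq_smul_one (R := R), mul_sub, sub_mul, mul_add, add_mul, smul_mul_assoc,
      mul_smul_comm, mul_one, one_mul, mul_assoc, h.rules_one,
      h.symm.rules_one, h.rules_mixed, h.symm.rules_mixed, h.rules_conj, smul_sub, smul_add]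
    module
  rel_A := by
    simp only [ofNat_eq_smul_one (R := R), mul_sub, sub_mul, mul_add, add_mul, smul_mul_assoc,
      mul_smul_comm, mul_one, one_mul, mul_assoc, h.rules_one,
      h.symm.rules_one, h.rules_mixed, h.symm.rules_mixed, h.rules_conj, smul_sub, smul_add,
        pow_two, neg_mul]
    module
  rel_B := by
    simp only [ofNat_eq_smul_one (R := R), mul_sub, sub_mul, mul_add, add_mul, smul_mul_assoc,
      mul_smul_comm, mul_one, one_mul, mul_assoc, h.rules_one,
      h.symm.rules_one, h.rules_mixed, h.symm.rules_mixed, h.rules_conj, smul_sub, smul_add,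
        pow_two, neg_mul]
    module
  char_A := h.char_two_mul_add_four
  char_B := h.symm.char_two_mul_add_four
  char_D := by
    -- K₁₃ is the conjugate of K₂₃ by s₁, so it inherits the cubic.
    have e : 2 * (s₁ - e₁ + (s₂ - e₂) + (s₁ * s₂ * s₁ - s₁ * e₂ * s₁)) + 6 - (2 * (s₁ - e₁) + 4) -
        (2 * (s₂ - e₂) + 4) + 6 = s₁ * (2 * (s₂ - e₂) + 4) * s₁ := by
      simp only [ofNat_eq_smul_one (R := R), mul_sub, sub_mul, mul_add, add_mul, smul_mul_assoc,
        mul_smul_comm, mul_one, one_mul, mul_assoc, h.rules_one, smul_sub, smul_add]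
      module
    rw [e]
    rw [h.conj_sub_ofNat, h.conj_sub_ofNat, h.conj_mul_conj, h.conj_mul_conj,
      h.symm.char_two_mul_add_four, mul_zero, zero_mul]
  char_C := h.quartic rfl
  char_CA := by
    have e : 2 * (s₁ - e₁ + (s₂ - e₂) + (s₁ * s₂ * s₁ - s₁ * e₂ * s₁)) + 6 -
        (2 * (s₁ - e₁) + 4) = 2 * (s₂ - e₂ + (s₁ * s₂ * s₁ - s₁ * e₂ * s₁)) + 2 := by
      simp only [ofNat_eq_smul_one (R := R), smul_mul_assoc, one_mul]
      module
    rw [e]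
    exact h.sextic
  char_CB := by
    have key := h.symm.sextic
    rw [show s₂ * s₁ * s₂ = s₁ * s₂ * s₁ from h.braid.symm, h.s₂_e₁_s₂] at key
    have e : 2 * (s₁ - e₁ + (s₂ - e₂) + (s₁ * s₂ * s₁ - s₁ * e₂ * s₁)) + 6 -
        (2 * (s₂ - e₂) + 4) = 2 * (s₁ - e₁ + (s₁ * s₂ * s₁ - s₁ * e₂ * s₁)) + 2 := by
      simp only [ofNat_eq_smul_one (R := R), smul_mul_assoc, one_mul]
      module
    rw [e]
    exact key
  char_CD := by
    -- Conjugation by s₂ exchanges K₁₂ and K₁₃, which reduces this case to the one for C - A.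
    have e : 2 * (s₁ - e₁) + 4 + (2 * (s₂ - e₂) + 4) - 6 =
        s₂ * (2 * (s₂ - e₂ + (s₁ * s₂ * s₁ - s₁ * e₂ * s₁)) + 2) * s₂ := by
      simp only [ofNat_eq_smul_one (R := R), mul_sub, sub_mul, mul_add, add_mul, smul_mul_assoc,
        mul_smul_comm, mul_one, one_mul, mul_assoc, h.rules_one,
        h.symm.rules_one, h.rules_mixed, h.symm.rules_mixed, h.rules_conj, smul_sub, smul_add]
      module
    rw [e]
    simp only [h.symm.conj_sub_ofNat, h.symm.conj_add_ofNat, h.symm.conj_mul_conj]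
    rw [h.sextic, mul_zero, zero_mul]

end IsBrauerQuadruple

theorem isBrauerQuadruple_brauerGen : IsBrauerQuadruple (brauerGen 3 .s₁) (brauerGen 3 .s₂)
    (brauerGen 3 .e₁) (brauerGen 3 .e₂) := by
  have hg (g : BrauerGen) : RingQuot.mkAlgHom ℂ (BrauerRel 3) (FreeAlgebra.ι ℂ g) =
    brauerGen 3 g := rfl
  constructor
  · simpa only [map_mul, map_pow, map_one, hg, pow_two] using
      RingQuot.mkAlgHom_rel ℂ (BrauerRel.s₁_sq (η := 3))
  · simpa only [map_mul, map_pow, map_one, hg, pow_two] using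
      RingQuot.mkAlgHom_rel ℂ (BrauerRel.s₂_sq (η := 3))
  · simpa only [map_mul, map_pow, map_smul, hg, pow_two] using
      RingQuot.mkAlgHom_rel ℂ (BrauerRel.e₁_sq (η := 3))
  · simpa only [map_mul, map_pow, map_smul, hg, pow_two] using
      RingQuot.mkAlgHom_rel ℂ (BrauerRel.e₂_sq (η := 3))
  · simpa only [map_mul, hg] using RingQuot.mkAlgHom_rel ℂ (BrauerRel.s₁_e₁ (η := 3))
  · simpa only [map_mul, hg] using RingQuot.mkAlgHom_rel ℂ (BrauerRel.e₁_s₁ (η := 3))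
  · simpa only [map_mul, hg] using RingQuot.mkAlgHom_rel ℂ (BrauerRel.s₂_e₂ (η := 3))
  · simpa only [map_mul, hg] using RingQuot.mkAlgHom_rel ℂ (BrauerRel.e₂_s₂ (η := 3))
  · simpa only [map_mul, hg] using RingQuot.mkAlgHom_rel ℂ (BrauerRel.braid (η := 3))
  · simpa only [map_mul, hg] using RingQuot.mkAlgHom_rel ℂ (BrauerRel.e₁_e₂_e₁ (η := 3))
  · simpa only [map_mul, hg] using RingQuot.mkAlgHom_rel ℂ (BrauerRel.e₂_e₁_e₂ (η := 3))
  · simpa only [map_mul, hg] using RingQuot.mkAlgHom_rel ℂ (BrauerRel.s₁_e₂_e₁ (η := 3))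
  · simpa only [map_mul, hg] using RingQuot.mkAlgHom_rel ℂ (BrauerRel.e₂_e₁_s₂ (η := 3))

theorem brauer_hom_ext {R : Type} [Ring R] [Algebra ℂ R] {f g : BrauerAlgebra 3 →ₐ[ℂ] R}
    (h : ∀ x, f (brauerGen 3 x) = g (brauerGen 3 x)) : f = g :=
  RingQuot.ringQuot_ext' _ _ _ (FreeAlgebra.hom_ext (funext h))

namespace IsBrauerQuadruple
variable {R : Type} [Ring R] [Algebra ℂ R] {s₁ s₂ e₁ e₂ : R}

/-- The images of the generators of the Brauer algebra under the specialization at a quadruple. -/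
def genMap (s₁ s₂ e₁ e₂ : R) : BrauerGen → R
  | .s₁ => s₁
  | .s₂ => s₂
  | .e₁ => e₁
  | .e₂ => e₂

theorem exists_lift (h : IsBrauerQuadruple s₁ s₂ e₁ e₂) :
    ∃ f : BrauerAlgebra 3 →ₐ[ℂ] R, ∀ g, f (brauerGen 3 g) = genMap s₁ s₂ e₁ e₂ g := by
  let f₀ : FreeAlgebra ℂ BrauerGen →ₐ[ℂ] R := FreeAlgebra.lift ℂ (genMap s₁ s₂ e₁ e₂)
  have h₀ (g : BrauerGen) : f₀ (FreeAlgebra.ι ℂ g) = genMap s₁ s₂ e₁ e₂ g :=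
    FreeAlgebra.lift_ι_apply _ _
  have hrel ⦃x y : FreeAlgebra ℂ BrauerGen⦄ (hxy : BrauerRel 3 x y) : f₀ x = f₀ y := by
    cases hxy <;> simp only [map_mul, map_pow, map_smul, map_one, h₀, genMap, pow_two]
    exacts [h.s₁_sq, h.s₂_sq, h.e₁_sq, h.e₂_sq, h.s₁_e₁, h.e₁_s₁, h.s₂_e₂, h.e₂_s₂, h.braid,
      h.e₁_e₂_e₁, h.e₂_e₁_e₂, h.s₁_e₂_e₁, h.e₂_e₁_s₂]
  refine ⟨RingQuot.liftAlgHom ℂ ⟨f₀, hrel⟩, fun g => ?_⟩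
  rw [← h₀]
  exact RingQuot.liftAlgHom_mkAlgHom_apply _ _ _ _

end IsBrauerQuadruple

/-! ### The isomorphism with the Brauer algebra -/

theorem IsRacahTriple.isBrauerQuadruple {R : Type*} [Ring R] [Algebra ℂ R] {A B C : R}
    (h : IsRacahTriple A B C) :
    IsBrauerQuadruple (swapOf A) (swapOf B) (capOf A) (capOf B) where
  s₁_sq := swapOf_mul_self h.char_A
  s₂_sq := swapOf_mul_self h.char_B
  e₁_sq := capOf_mul_self h.char_A
  e₂_sq := capOf_mul_self h.char_B
  s₁_e₁ := swapOf_mul_capOf h.char_A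
  e₁_s₁ := capOf_mul_swapOf h.char_A
  s₂_e₂ := swapOf_mul_capOf h.char_B
  e₂_s₂ := capOf_mul_swapOf h.char_B
  braid := h.braid
  e₁_e₂_e₁ := h.capOf_mul_capOf_mul_capOf
  e₂_e₁_e₂ := h.symm.capOf_mul_capOf_mul_capOf
  s₁_e₂_e₁ := h.swapOf_mul_capOf_mul_capOf
  e₂_e₁_s₂ := h.capOf_mul_capOf_mul_swapOf

theorem map_swapOf {R S : Type*} [Ring R] [Algebra ℂ R] [Ring S] [Algebra ℂ S] (f : R →ₐ[ℂ] S)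
    (x : R) : f (swapOf x) = swapOf (f x) := by
  simp only [swapOf_eq, map_smul, map_add, map_sub, map_mul, map_one]

theorem map_capOf {R S : Type*} [Ring R] [Algebra ℂ R] [Ring S] [Algebra ℂ S] (f : R →ₐ[ℂ] S)
    (x : R) : f (capOf x) = capOf (f x) := by
  simp only [capOf, proj₀_eq, map_smul, map_add, map_sub, map_mul, map_one]

theorem map_two_mul_sub_add_four {R S : Type*} [Ring R] [Algebra ℂ R] [Ring S] [Algebra ℂ S]
    (f : R →ₐ[ℂ] S) (x y : R) : f (2 * (x - y) + 4) = 2 * (f x - f y) + 4 := by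
  simp only [map_add, map_mul, map_sub, map_ofNat]

namespace IsBrauerQuadruple
variable {R : Type*} [Ring R] [Algebra ℂ R] {s₁ s₂ e₁ e₂ : R}

theorem swapOf_eq_s₁ (h : IsBrauerQuadruple s₁ s₂ e₁ e₂) : swapOf (2 * (s₁ - e₁) + 4) = s₁ := by
  simp only [swapOf_eq, ofNat_eq_smul_one (R := R), mul_sub, sub_mul, mul_add, add_mul,
    smul_mul_assoc, mul_smul_comm, mul_one, one_mul, h.rules_one, smul_sub, smul_add]
  module

theorem capOf_eq_e₁ (h : IsBrauerQuadruple s₁ s₂ e₁ e₂) : capOf (2 * (s₁ - e₁) + 4) = e₁ := by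
  simp only [capOf, proj₀_eq, ofNat_eq_smul_one (R := R), mul_sub, sub_mul, mul_add, add_mul,
    smul_mul_assoc, mul_smul_comm, mul_one, one_mul, h.rules_one, smul_sub, smul_add]
  module

end IsBrauerQuadruple

theorem exists_algEquiv_of_ext {Q S : Type*} [Ring Q] [Algebra ℂ Q] [Ring S] [Algebra ℂ S]
    {A B : Q} {s₁ s₂ e₁ e₂ : S} (hB : IsBrauerQuadruple s₁ s₂ e₁ e₂)
    (f : Q →ₐ[ℂ] S) (g : S →ₐ[ℂ] Q)
    (hfA : f A = 2 * (s₁ - e₁) + 4) (hfB : f B = 2 * (s₂ - e₂) + 4)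
    (hg₁ : g s₁ = swapOf A) (hg₂ : g s₂ = swapOf B) (hg₃ : g e₁ = capOf A) (hg₄ : g e₂ = capOf B)
    (extQ : ∀ f g : Q →ₐ[ℂ] Q, f A = g A → f B = g B → f = g)
    (extS : ∀ f g : S →ₐ[ℂ] S, f s₁ = g s₁ → f s₂ = g s₂ → f e₁ = g e₁ → f e₂ = g e₂ → f = g) :
    ∃ ψ : Q ≃ₐ[ℂ] S, ∀ x, ψ x = f x := by
  have hfg : f.comp g = AlgHom.id ℂ S := by
    apply extS <;> simp only [AlgHom.comp_apply, AlgHom.id_apply, hg₁, hg₂, hg₃, hg₄, map_swapOf,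
      map_capOf, hfA, hfB, hB.swapOf_eq_s₁, hB.capOf_eq_e₁, hB.symm.swapOf_eq_s₁,
      hB.symm.capOf_eq_e₁]
  have hgf : g.comp f = AlgHom.id ℂ Q := by
    apply extQ <;> simp only [AlgHom.comp_apply, AlgHom.id_apply, hfA, hfB,
      map_two_mul_sub_add_four, hg₁, hg₂, hg₃, hg₄, two_mul_swapOf_sub_capOf]
  exact ⟨AlgEquiv.ofAlgHom f g hfg hgf, fun _ => rfl⟩

theorem exists_algEquiv_brauer : ∃ ψ : QuotientRacah 2 2 2 ≃ₐ[ℂ] BrauerAlgebra 3,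
    ψ (quotGen 2 2 2 .A) = 2 * (brauerGen 3 .s₁ - brauerGen 3 .e₁) + 4 ∧
    ψ (quotGen 2 2 2 .B) = 2 * (brauerGen 3 .s₂ - brauerGen 3 .e₂) + 4 ∧
    ψ (quotGen 2 2 2 .C) = 2 * (brauerGen 3 .s₁ - brauerGen 3 .e₁ +
      (brauerGen 3 .s₂ - brauerGen 3 .e₂) + (brauerGen 3 .s₁ * brauerGen 3 .s₂ * brauerGen 3 .s₁ -
        brauerGen 3 .s₁ * brauerGen 3 .e₂ * brauerGen 3 .s₁)) + 6 := by
  obtain ⟨f, hfA, hfB, hfC⟩ := isBrauerQuadruple_brauerGen.isRacahTriple.exists_lift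
  obtain ⟨g, hg⟩ := isRacahTriple_quotGen.isBrauerQuadruple.exists_lift
  obtain ⟨ψ, hψ⟩ := exists_algEquiv_of_ext (A := quotGen 2 2 2 .A)
    (B := quotGen 2 2 2 .B) isBrauerQuadruple_brauerGen f g hfA hfB (hg .s₁)
    (hg .s₂) (hg .e₁) (hg .e₂) (fun u v hA hB => quotientRacah_hom_ext (R :=
      QuotientRacah 2 2 2) (f := u) (g := v) hA hB)
    (fun u v h₁ h₂ h₃ h₄ => brauer_hom_ext (f := u) (g := v) fun x => by
      cases x
      exacts [h₁, h₂, h₃, h₄])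
  exact ⟨ψ, (hψ _).trans hfA, (hψ _).trans hfB, (hψ _).trans hfC⟩

/-! ### The Brauer algebra acting on the tensor cube -/

/-- The space of the coordinates of the tensors of order three. -/
abbrev TensorSpace : Type := Fin 3 × Fin 3 × Fin 3 → ℂ

/-- The coordinates of the invariant vector in `[2] ⊗ [2]`. -/
noncomputable def invVec : Fin 3 → Fin 3 → ℂ := ![![0, 0, 1], ![0, -1 / 2, 0], ![1, 0, 0]]

/-- The permutation of the first two tensor factors. -/
def swap₁₂ : Module.End ℂ TensorSpace where
  toFun f p := f (p.2.1, p.1, p.2.2)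
  map_add' _ _ := rfl
  map_smul' _ _ := rfl

/-- The permutation of the last two tensor factors. -/
def swap₂₃ : Module.End ℂ TensorSpace where
  toFun f p := f (p.1, p.2.2, p.2.1)
  map_add' _ _ := rfl
  map_smul' _ _ := rfl

/-- The permutation of the outer tensor factors. -/
def swap₁₃ : Module.End ℂ TensorSpace where
  toFun f p := f (p.2.2, p.2.1, p.1)
  map_add' _ _ := rfl
  map_smul' _ _ := rfl

/-- The contraction of the first two tensor factors followed by the invariant vector. -/
noncomputable def cap₁₂ : Module.End ℂ TensorSpace where
  toFun f p := invVec p.1 p.2.1 * (f (0, 2, p.2.2) - 2 * f (1, 1, p.2.2) + f (2, 0, p.2.2))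
  map_add' f g := by ext; simp only [Pi.add_apply]; ring
  map_smul' c f := by ext; simp only [Pi.smul_apply, smul_eq_mul, RingHom.id_apply]; ring

/-- The contraction of the last two tensor factors followed by the invariant vector. -/
noncomputable def cap₂₃ : Module.End ℂ TensorSpace where
  toFun f p := invVec p.2.1 p.2.2 * (f (p.1, 0, 2) - 2 * f (p.1, 1, 1) + f (p.1, 2, 0))
  map_add' f g := by ext; simp only [Pi.add_apply]; ring
  map_smul' c f := by ext; simp only [Pi.smul_apply, smul_eq_mul, RingHom.id_apply]; ring

/-- The contraction of the outer tensor factors followed by the invariant vector. -/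
noncomputable def cap₁₃ : Module.End ℂ TensorSpace where
  toFun f p := invVec p.1 p.2.2 * (f (0, p.2.1, 2) - 2 * f (1, p.2.1, 1) + f (2, p.2.1, 0))
  map_add' f g := by ext; simp only [Pi.add_apply]; ring
  map_smul' c f := by ext; simp only [Pi.smul_apply, smul_eq_mul, RingHom.id_apply]; ring

section Apply
variable (f : TensorSpace) (i j k : Fin 3)

theorem swap₁₂_apply : swap₁₂ f (i, j, k) = f (j, i, k) := rfl

theorem swap₂₃_apply : swap₂₃ f (i, j, k) = f (i, k, j) := rfl

theorem swap₁₃_apply : swap₁₃ f (i, j, k) = f (k, j, i) := rfl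

theorem cap₁₂_apply : cap₁₂ f (i, j, k) =
    invVec i j * (f (0, 2, k) - 2 * f (1, 1, k) + f (2, 0, k)) := rfl

theorem cap₂₃_apply : cap₂₃ f (i, j, k) =
    invVec j k * (f (i, 0, 2) - 2 * f (i, 1, 1) + f (i, 2, 0)) := rfl

theorem cap₁₃_apply : cap₁₃ f (i, j, k) =
    invVec i k * (f (0, j, 2) - 2 * f (1, j, 1) + f (2, j, 0)) := rfl

end Apply

theorem invVec_comm (i j : Fin 3) : invVec i j = invVec j i := by
  fin_cases i <;> fin_cases j <;> rfl

theorem fin_three_cases (i : Fin 3) : i = 0 ∨ i = 1 ∨ i = 2 := by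
  fin_cases i <;> simp

theorem invVec_apply : (invVec 0 0 = 0 ∧ invVec 0 1 = 0 ∧ invVec 0 2 = 1) ∧
    (invVec 1 0 = 0 ∧ invVec 1 1 = -1 / 2 ∧ invVec 1 2 = 0) ∧
    (invVec 2 0 = 1 ∧ invVec 2 1 = 0 ∧ invVec 2 2 = 0) :=
  ⟨⟨rfl, rfl, rfl⟩, ⟨rfl, rfl, rfl⟩, ⟨rfl, rfl, rfl⟩⟩

/-- The form (1, -2, 1) on the antidiagonal and the vector `invVec` are inverse matrices, which
gives e₁e₂e₁ = e₁. Their full contraction is 1 + 1 + 1 = 3, the parameter of the algebra. -/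
theorem isBrauerQuadruple_swap_cap : IsBrauerQuadruple swap₁₂ swap₂₃ cap₁₂ cap₂₃ := by
  constructor <;> refine LinearMap.ext fun f => funext fun ⟨i, j, k⟩ => ?_ <;>
    simp only [Module.End.mul_apply, Module.End.one_apply, LinearMap.smul_apply, Pi.smul_apply,
      smul_eq_mul, swap₁₂_apply, swap₂₃_apply, cap₁₂_apply, cap₂₃_apply]
  · simp only [invVec_apply]
    ring
  · simp only [invVec_apply]
    ring
  · rw [invVec_comm]
  · ring
  · rw [invVec_comm]
  · ring
  · rcases fin_three_cases k with rfl | rfl | rfl <;> simp only [invVec_apply] <;> ring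
  · rcases fin_three_cases i with rfl | rfl | rfl <;> simp only [invVec_apply] <;> ring
  · rcases fin_three_cases j with rfl | rfl | rfl <;> simp only [invVec_apply] <;> ring
  · rcases fin_three_cases i with rfl | rfl | rfl <;> simp only [invVec_apply] <;> ring

theorem swap_conj_swap : swap₁₂ * swap₂₃ * swap₁₂ = swap₁₃ := rfl

theorem swap_conj_cap : swap₁₂ * cap₂₃ * swap₁₂ = cap₁₃ := rfl

/-! ### A basis of fifteen words -/

/-- The normal words of the Brauer algebra on three strands. -/
def normalWord {R : Type*} [Ring R] (s₁ s₂ e₁ e₂ : R) : Fin 15 → R :=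
  ![1, s₁, s₂, e₁, e₂, s₁ * s₂, s₂ * s₁, s₁ * e₂, e₂ * s₁, s₂ * e₁, e₁ * s₂, e₁ * e₂, e₂ * e₁,
    s₁ * (s₂ * s₁), s₁ * (e₂ * s₁)]

theorem sum_smul_normalWord {R : Type*} [Ring R] [Algebra ℂ R] (s₁ s₂ e₁ e₂ : R)
    (c : Fin 15 → ℂ) : ∑ i, c i • normalWord s₁ s₂ e₁ e₂ i =
      c 0 • 1 + c 1 • s₁ + c 2 • s₂ + c 3 • e₁ + c 4 • e₂ + c 5 • (s₁ * s₂) + c 6 • (s₂ * s₁) +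
      c 7 • (s₁ * e₂) + c 8 • (e₂ * s₁) + c 9 • (s₂ * e₁) + c 10 • (e₁ * s₂) + c 11 • (e₁ * e₂) +
      c 12 • (e₂ * e₁) + c 13 • (s₁ * (s₂ * s₁)) + c 14 • (s₁ * (e₂ * s₁)) := by
  simp only [Fin.sum_univ_succ, Fin.sum_univ_zero, add_zero, add_assoc]
  rfl

theorem linearIndependent_normalWord :
    LinearIndependent ℂ (normalWord swap₁₂ swap₂₃ cap₁₂ cap₂₃) := by
  rw [Fintype.linearIndependent_iff]
  intro c hc
  rw [sum_smul_normalWord] at hc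
  -- Fifteen matrix entries, at weight-preserving positions, give a linear system that forces all
  -- the coefficients to vanish.
  have ev (q p : Fin 3 × Fin 3 × Fin 3) := congrFun (LinearMap.congr_fun hc (Pi.single q 1)) p
  have h₁ := ev (0, 0, 1) (0, 0, 1)
  have h₂ := ev (0, 1, 0) (0, 0, 1)
  have h₃ := ev (1, 0, 0) (0, 0, 1)
  have h₄ := ev (0, 1, 1) (0, 0, 2)
  have h₅ := ev (1, 0, 1) (0, 0, 2)
  have h₆ := ev (1, 1, 0) (0, 0, 2)
  have h₇ := ev (0, 0, 1) (0, 1, 0)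
  have h₈ := ev (0, 1, 0) (0, 1, 0)
  have h₉ := ev (0, 0, 2) (0, 1, 1)
  have h₁₀ := ev (0, 2, 0) (0, 1, 1)
  have h₁₁ := ev (2, 0, 0) (0, 1, 1)
  have h₁₂ := ev (0, 1, 2) (0, 1, 2)
  have h₁₃ := ev (0, 1, 1) (0, 2, 0)
  have h₁₄ := ev (1, 0, 1) (0, 2, 0)
  have h₁₅ := ev (1, 1, 0) (0, 2, 0)
  clear ev hc
  simp only [LinearMap.add_apply, LinearMap.smul_apply, Module.End.mul_apply,
    Module.End.one_apply, Pi.add_apply, Pi.smul_apply, smul_eq_mul, swap₁₂_apply, swap₂₃_apply,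
    cap₁₂_apply, cap₂₃_apply, invVec_apply, Pi.single_apply, Prod.mk.injEq, LinearMap.zero_apply,
    Pi.zero_apply] at h₁ h₂ h₃ h₄ h₅ h₆ h₇ h₈ h₉ h₁₀ h₁₁ h₁₂ h₁₃ h₁₄ h₁₅
  simp at h₁ h₂ h₃ h₄ h₅ h₆ h₇ h₈ h₉ h₁₀ h₁₁ h₁₂ h₁₃ h₁₄ h₁₅
  have e : c 0 = 0 ∧ c 1 = 0 ∧ c 2 = 0 ∧ c 3 = 0 ∧ c 4 = 0 ∧ c 5 = 0 ∧ c 6 = 0 ∧ c 7 = 0 ∧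
      c 8 = 0 ∧ c 9 = 0 ∧ c 10 = 0 ∧ c 11 = 0 ∧ c 12 = 0 ∧ c 13 = 0 ∧ c 14 = 0 := by
    grind
  obtain ⟨e₀, e₁, e₂, e₃, e₄, e₅, e₆, e₇, e₈, e₉, e₁₀, e₁₁, e₁₂, e₁₃, e₁₄⟩ := e
  intro i
  fin_cases i <;> assumption

theorem map_normalWord {R S : Type*} [Ring R] [Algebra ℂ R] [Ring S] [Algebra ℂ S]
    (f : R →ₐ[ℂ] S) (s₁ s₂ e₁ e₂ : R) (i : Fin 15) :
    f (normalWord s₁ s₂ e₁ e₂ i) = normalWord (f s₁) (f s₂) (f e₁) (f e₂) i := by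
  fin_cases i <;> simp [normalWord]

namespace IsBrauerQuadruple
variable {R : Type*} [Ring R] [Algebra ℂ R] {s₁ s₂ e₁ e₂ : R}

theorem mul_mem_span_normalWord (h : IsBrauerQuadruple s₁ s₂ e₁ e₂) {g : R} (hg : g = s₁ ∨ g =
    s₂ ∨ g = e₁ ∨ g = e₂) {x : R}
    (hx : x ∈ Submodule.span ℂ (Set.range (normalWord s₁ s₂ e₁ e₂))) :
    g * x ∈ Submodule.span ℂ (Set.range (normalWord s₁ s₂ e₁ e₂)) := by
  have mem (i) := Submodule.subset_span (R := ℂ) (Set.mem_range_self (f :=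
    normalWord s₁ s₂ e₁ e₂) i)
  have h₀ := mem 0
  have h₁ := mem 1
  have h₂ := mem 2
  have h₃ := mem 3
  have h₄ := mem 4
  have h₅ := mem 5
  have h₆ := mem 6
  have h₇ := mem 7
  have h₈ := mem 8
  have h₉ := mem 9
  have h₁₀ := mem 10
  have h₁₁ := mem 11
  have h₁₂ := mem 12
  have h₁₃ := mem 13
  have h₁₄ := mem 14
  clear mem
  induction hx using Submodule.span_induction with
  | zero => simp
  | add x y _ _ hx hy => rw [mul_add]; exact add_mem hx hy
  | smul c x _ hx => rw [mul_smul_comm]; exact Submodule.smul_mem _ _ hx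
  | mem x hx =>
    obtain ⟨i, rfl⟩ := hx
    generalize Submodule.span ℂ (Set.range (normalWord s₁ s₂ e₁ e₂)) = M at *
    dsimp only [normalWord, Fin.isValue, Matrix.cons_val]
      at h₀ h₁ h₂ h₃ h₄ h₅ h₆ h₇ h₈ h₉ h₁₀ h₁₁ h₁₂ h₁₃ h₁₄
    have sm (x : R) (hx : x ∈ M) : (3 : ℂ) • x ∈ M := M.smul_mem _ hx
    rcases hg with rfl | rfl | rfl | rfl <;> fin_cases i <;>
      simp only [normalWord, Fin.mk_zero, Fin.mk_one, Fin.reduceFinMk, Fin.isValue,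
        Matrix.cons_val, mul_one, h.rules_one, h.symm.rules_one, h.rules_mixed,
        h.symm.rules_mixed, h.rules_conj] <;>
      first | assumption | (apply sm; assumption)

end IsBrauerQuadruple

theorem span_normalWord_brauerGen : Submodule.span ℂ (Set.range (normalWord (brauerGen 3 .s₁)
    (brauerGen 3 .s₂) (brauerGen 3 .e₁) (brauerGen 3 .e₂))) = ⊤ := by
  rw [eq_top_iff]
  rintro x -
  obtain ⟨a, rfl⟩ := RingQuot.mkAlgHom_surjective ℂ (BrauerRel 3) x
  have key : ∀ a : FreeAlgebra ℂ BrauerGen, ∀ y ∈ Submodule.span ℂ (Set.range (normalWord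
      (brauerGen 3 .s₁) (brauerGen 3 .s₂) (brauerGen 3 .e₁) (brauerGen 3 .e₂))),
      RingQuot.mkAlgHom ℂ (BrauerRel 3) a * y ∈ Submodule.span ℂ (Set.range (normalWord
        (brauerGen 3 .s₁) (brauerGen 3 .s₂) (brauerGen 3 .e₁) (brauerGen 3 .e₂))) := by
    intro a
    induction a using FreeAlgebra.induction with
    | grade0 c =>
      intro y hy
      rw [AlgHom.commutes, ← Algebra.smul_def]
      exact Submodule.smul_mem _ _ hy
    | grade1 g =>
      intro y hy
      refine isBrauerQuadruple_brauerGen.mul_mem_span_normalWord ?_ hy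
      cases g
      · exact Or.inl rfl
      · exact Or.inr (Or.inl rfl)
      · exact Or.inr (Or.inr (Or.inl rfl))
      · exact Or.inr (Or.inr (Or.inr rfl))
    | mul a b ha hb =>
      intro y hy
      rw [map_mul, mul_assoc]
      exact ha _ (hb _ hy)
    | add a b ha hb =>
      intro y hy
      rw [map_add, add_mul]
      exact add_mem (ha _ hy) (hb _ hy)
  -- The span is stable under left multiplication and contains 1, so it is everything.
  have := key a 1 (Submodule.subset_span ⟨0, rfl⟩)
  rwa [mul_one] at this

theorem exists_brauer_rep : ∃ g : BrauerAlgebra 3 →ₐ[ℂ] Module.End ℂ TensorSpace,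
    (g (brauerGen 3 .s₁) = swap₁₂ ∧ g (brauerGen 3 .s₂) = swap₂₃ ∧ g (brauerGen 3 .e₁) = cap₁₂ ∧
      g (brauerGen 3 .e₂) = cap₂₃) ∧ Function.Injective g ∧
    Module.finrank ℂ (BrauerAlgebra 3) = 15 := by
  obtain ⟨g, hg⟩ := isBrauerQuadruple_swap_cap.exists_lift
  let w : Fin 15 → BrauerAlgebra 3 := normalWord (brauerGen 3 .s₁) (brauerGen 3 .s₂)
    (brauerGen 3 .e₁) (brauerGen 3 .e₂)
  have hgw : g.toLinearMap ∘ w = normalWord swap₁₂ swap₂₃ cap₁₂ cap₂₃ := by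
    funext i
    refine (map_normalWord g _ _ _ _ i).trans ?_
    rw [hg, hg, hg, hg]
    rfl
  have li : LinearIndependent ℂ (g.toLinearMap ∘ w) := by
    rw [hgw]
    exact linearIndependent_normalWord
  have sp := span_normalWord_brauerGen
  let b : Module.Basis (Fin 15) ℂ (BrauerAlgebra 3) :=
    Module.Basis.mk (LinearIndependent.of_comp _ li) sp.ge
  refine ⟨g, ⟨hg _, hg _, hg _, hg _⟩, ?_, ?_⟩
  · rw [injective_iff_map_eq_zero]
    intro x hx
    have hb (i : Fin 15) : b i = w i := Module.Basis.mk_apply _ _ i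
    have key : ∑ i, b.repr x i • (g.toLinearMap ∘ w) i = 0 := by
      have : g.toLinearMap (∑ i, b.repr x i • b i) = 0 := by rw [b.sum_repr]; exact hx
      simpa only [map_sum, map_smul, hb, Function.comp_apply] using this
    have z := Fintype.linearIndependent_iff.1 li _ key
    rw [← b.sum_repr x]
    exact Finset.sum_eq_zero fun i _ => by rw [z i, zero_smul]
  · rw [Module.finrank_eq_card_basis b, Fintype.card_fin]

/-! ### The diagonal action of su(2) -/

/-- The action on `[2] ⊗ [2] ⊗ [2]` of the sum over the sites of an operator on `[2]`. -/
def totalOp (A : Matrix (Fin 3) (Fin 3) ℂ) : EndTensor 2 2 2 :=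
  A ⊗ₖ (1 ⊗ₖ 1) + 1 ⊗ₖ (A ⊗ₖ 1) + 1 ⊗ₖ (1 ⊗ₖ A)

theorem totalOp_add (A B : Matrix (Fin 3) (Fin 3) ℂ) : totalOp (A + B) = totalOp A + totalOp B := by
  simp only [totalOp, Matrix.add_kronecker, Matrix.kronecker_add]
  abel

theorem totalOp_smul (c : ℂ) (A : Matrix (Fin 3) (Fin 3) ℂ) : totalOp (c • A) = c • totalOp A := by
  simp only [totalOp, Matrix.smul_kronecker, Matrix.kronecker_smul, smul_add]

theorem siteOne_mulVec (A : Matrix (Fin 3) (Fin 3) ℂ) (f : TensorSpace) (i j k : Fin 3) :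
    (A ⊗ₖ ((1 : Matrix (Fin 3) (Fin 3) ℂ) ⊗ₖ (1 : Matrix (Fin 3) (Fin 3) ℂ))).mulVec f (i, j, k) =
      ∑ a, A i a * f (a, j, k) := by
  simp [Matrix.mulVec, dotProduct, Fintype.sum_prod_type, Matrix.one_apply, mul_ite, ite_mul]

theorem siteTwo_mulVec (A : Matrix (Fin 3) (Fin 3) ℂ) (f : TensorSpace) (i j k : Fin 3) :
    ((1 : Matrix (Fin 3) (Fin 3) ℂ) ⊗ₖ (A ⊗ₖ (1 : Matrix (Fin 3) (Fin 3) ℂ))).mulVec f (i, j, k) =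
      ∑ a, A j a * f (i, a, k) := by
  simp [Matrix.mulVec, dotProduct, Fintype.sum_prod_type, Matrix.one_apply, mul_ite, ite_mul,
    Finset.sum_ite_irrel]

theorem siteThree_mulVec (A : Matrix (Fin 3) (Fin 3) ℂ) (f : TensorSpace) (i j k : Fin 3) :
    ((1 : Matrix (Fin 3) (Fin 3) ℂ) ⊗ₖ ((1 : Matrix (Fin 3) (Fin 3) ℂ) ⊗ₖ A)).mulVec f (i, j, k) =
      ∑ a, A k a * f (i, j, a) := by
  simp [Matrix.mulVec, dotProduct, Fintype.sum_prod_type, Matrix.one_apply, mul_ite, ite_mul,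
    Finset.sum_ite_irrel]

theorem totalOp_mulVec (A : Matrix (Fin 3) (Fin 3) ℂ) (f : TensorSpace) (i j k : Fin 3) :
    (totalOp A).mulVec f (i, j, k) =
      ∑ a, A i a * f (a, j, k) + ∑ a, A j a * f (i, a, k) + ∑ a, A k a * f (i, j, a) := by
  rw [totalOp, Matrix.add_mulVec, Matrix.add_mulVec, Pi.add_apply, Pi.add_apply, siteOne_mulVec,
    siteTwo_mulVec, siteThree_mulVec]

theorem totalOp_mulVec_single (A : Matrix (Fin 3) (Fin 3) ℂ) (a b c : Fin 3) :
    (totalOp A).mulVec (Pi.single (a, b, c) 1) =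
      ∑ i, A i a • Pi.single (i, b, c) 1 + ∑ i, A i b • Pi.single (a, i, c) 1 +
        ∑ i, A i c • Pi.single (a, b, i) 1 := by
  funext ⟨i, j, k⟩
  rw [totalOp_mulVec]
  simp [Pi.single_apply, Finset.sum_apply, ite_and]

theorem raising_eq : raising 2 = !![0, 2, 0; 0, 0, 1; 0, 0, 0] := by
  ext i j
  fin_cases i <;> fin_cases j <;> simp [raising] <;> norm_num

theorem lowering_eq : lowering 2 = !![0, 0, 0; 1, 0, 0; 0, 2, 0] := by
  ext i j
  fin_cases i <;> fin_cases j <;> simp [lowering]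

theorem spin_two_eq : spin 2 2 = !![1, 0, 0; 0, 0, 0; 0, 0, -1] := by
  ext i j
  fin_cases i <;> fin_cases j <;> simp [spin] <;> norm_num

theorem raising_eq_spin : raising 2 = spin 2 0 + Complex.I • spin 2 1 := by
  have h : Complex.I * (-Complex.I / 2) = 1 / 2 := by
    linear_combination (-1 / 2 : ℂ) * Complex.I_mul_I
  have : raising 2 = (1 / 2 : ℂ) • (raising 2 + lowering 2) +
      Complex.I • ((-Complex.I / 2) • (raising 2 - lowering 2)) := by
    rw [smul_smul, h]
    module
  exact this

theorem lowering_eq_spin : lowering 2 = spin 2 0 + (-Complex.I) • spin 2 1 := by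
  have h : -Complex.I * (-Complex.I / 2) = -1 / 2 := by
    linear_combination (1 / 2 : ℂ) * Complex.I_mul_I
  have : lowering 2 = (1 / 2 : ℂ) • (raising 2 + lowering 2) +
      (-Complex.I) • ((-Complex.I / 2) • (raising 2 - lowering 2)) := by
    rw [smul_smul, h]
    module
  exact this

theorem mem_spinCentralizer_iff {X : EndTensor 2 2 2} :
    X ∈ spinCentralizer 2 2 2 ↔ ∀ α, totalOp (spin 2 α) * X = X * totalOp (spin 2 α) :=
  (Subalgebra.mem_centralizer_iff ℂ).trans Set.forall_mem_range

theorem totalOp_comm_of_mem {X : EndTensor 2 2 2} (hX : X ∈ spinCentralizer 2 2 2) :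
    totalOp (raising 2) * X = X * totalOp (raising 2) ∧
    totalOp (lowering 2) * X = X * totalOp (lowering 2) ∧
    totalOp (spin 2 2) * X = X * totalOp (spin 2 2) := by
  rw [mem_spinCentralizer_iff] at hX
  refine ⟨?_, ?_, hX 2⟩
  · rw [raising_eq_spin, totalOp_add, totalOp_smul, add_mul, mul_add, smul_mul_assoc,
      mul_smul_comm, hX, hX]
  · rw [lowering_eq_spin, totalOp_add, totalOp_smul, add_mul, mul_add, smul_mul_assoc,
      mul_smul_comm, hX, hX]

/-! ### Highest-weight vectors and the bound on the centralizer -/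

/-- A highest-weight vector of weight `m` in `[2] ⊗ [2] ⊗ [2]`. -/
structure IsHighestWeight (m : ℂ) (v : TensorSpace) : Prop where
  raise : (totalOp (raising 2)).mulVec v = 0
  weight : (totalOp (spin 2 2)).mulVec v = m • v

namespace IsHighestWeight

variable {m : ℂ} {v : TensorSpace}

theorem mulVec (hv : IsHighestWeight m v) {X : EndTensor 2 2 2}
    (hX : X ∈ spinCentralizer 2 2 2) : IsHighestWeight m (X.mulVec v) := by
  obtain ⟨h₁, -, h₂⟩ := totalOp_comm_of_mem hX
  constructor
  · rw [Matrix.mulVec_mulVec, h₁, ← Matrix.mulVec_mulVec, hv.raise, Matrix.mulVec_zero]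
  · rw [Matrix.mulVec_mulVec, h₂, ← Matrix.mulVec_mulVec, hv.weight, Matrix.mulVec_smul]

theorem raise_apply (hv : IsHighestWeight m v) (i j k : Fin 3) :
    ∑ a, raising 2 i a * v (a, j, k) + ∑ a, raising 2 j a * v (i, a, k) +
      ∑ a, raising 2 k a * v (i, j, a) = 0 := by
  rw [← totalOp_mulVec, hv.raise, Pi.zero_apply]

theorem apply_eq_zero (hv : IsHighestWeight m v) (i j k : Fin 3)
    (h : spin 2 2 i i + spin 2 2 j j + spin 2 2 k k ≠ m) : v (i, j, k) = 0 := by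
  have := congrFun hv.weight (i, j, k)
  have d : spin 2 2 = Matrix.diagonal fun k : Fin 3 => ((2 : ℕ) : ℂ) / 2 - (k : ℕ) := rfl
  rw [totalOp_mulVec, Pi.smul_apply, smul_eq_mul] at this
  have e (l : Fin 3) (w : Fin 3 → ℂ) : ∑ a, spin 2 2 l a * w a = spin 2 2 l l * w l := by
    refine Finset.sum_eq_single l (fun b _ hb => ?_) (by simp)
    rw [d, Matrix.diagonal_apply_ne' _ hb, zero_mul]
  rw [e i fun a => v (a, j, k), e j fun a => v (i, a, k), e k fun a => v (i, j, a)] at this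
  refine (mul_eq_zero.1 (?_ : (spin 2 2 i i + spin 2 2 j j + spin 2 2 k k - m) * _ =
    0)).resolve_left
    (sub_ne_zero.2 h)
  linear_combination this

/-- In this lemma and the next three, the coordinates assumed to vanish are as many as the
multiplicity of the spin: 1, 2, 3, 1. Coordinates of the wrong weight are zero, and the raising
equations express the remaining ones through the chosen ones. -/
theorem eq_zero_three (hv : IsHighestWeight 3 v) (h : v (0, 0, 0) = 0) : v = 0 := by
  funext ⟨i, j, k⟩
  have := hv.apply_eq_zero i j k
  rw [spin_two_eq] at this
  revert this
  rcases fin_three_cases i with rfl | rfl | rfl <;> rcases fin_three_cases j with rfl | rfl | rfl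
    <;>
    rcases fin_three_cases k with rfl | rfl | rfl <;> intro this <;>
    first | exact h | exact this (by simp <;> norm_num)

theorem eq_zero_two (hv : IsHighestWeight 2 v) (h₁ : v (1, 0, 0) = 0) (h₂ : v (0, 1, 0) = 0) :
    v = 0 := by
  have h₃ := hv.raise_apply 0 0 0
  simp [raising_eq, Fin.sum_univ_three, h₁, h₂] at h₃
  funext ⟨i, j, k⟩
  have := hv.apply_eq_zero i j k
  rw [spin_two_eq] at this
  revert this
  rcases fin_three_cases i with rfl | rfl | rfl <;> rcases fin_three_cases j with rfl | rfl | rfl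
    <;>
    rcases fin_three_cases k with rfl | rfl | rfl <;> intro this <;>
    first | assumption | exact this (by simp <;> norm_num)

theorem eq_zero_one (hv : IsHighestWeight 1 v) (h₁ : v (1, 1, 0) = 0) (h₂ : v (1, 0, 1) = 0)
    (h₃ : v (0, 1, 1) = 0) : v = 0 := by
  have h₄ := hv.raise_apply 1 0 0
  have h₅ := hv.raise_apply 0 1 0
  have h₆ := hv.raise_apply 0 0 1
  simp [raising_eq, Fin.sum_univ_three, h₁, h₂, h₃] at h₄ h₅ h₆
  funext ⟨i, j, k⟩
  have := hv.apply_eq_zero i j k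
  rw [spin_two_eq] at this
  revert this
  rcases fin_three_cases i with rfl | rfl | rfl <;> rcases fin_three_cases j with rfl | rfl | rfl
    <;>
    rcases fin_three_cases k with rfl | rfl | rfl <;> intro this <;>
    first | assumption | exact this (by simp <;> norm_num)

theorem eq_zero_zero (hv : IsHighestWeight 0 v) (h : v (2, 1, 0) = 0) : v = 0 := by
  have h₁ := hv.raise_apply 2 0 0
  have h₂ := hv.raise_apply 0 2 0
  have h₃ := hv.raise_apply 0 0 2
  have h₄ := hv.raise_apply 1 1 0
  have h₅ := hv.raise_apply 1 0 1
  have h₆ := hv.raise_apply 0 1 1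
  simp [raising_eq, Fin.sum_univ_three, h] at h₁ h₂ h₃ h₄ h₅ h₆
  have g₁ : v (1, 1, 1) = 0 := by grind
  have g₂ : v (1, 2, 0) = 0 := by grind
  have g₃ : v (0, 2, 1) = 0 := by grind
  have g₄ : v (1, 0, 2) = 0 := by grind
  have g₅ : v (0, 1, 2) = 0 := by grind
  funext ⟨i, j, k⟩
  have := hv.apply_eq_zero i j k
  rw [spin_two_eq] at this
  revert this
  rcases fin_three_cases i with rfl | rfl | rfl <;> rcases fin_three_cases j with rfl | rfl | rfl
    <;>
    rcases fin_three_cases k with rfl | rfl | rfl <;> intro this <;>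
    first | assumption | exact this (by simp <;> norm_num)

end IsHighestWeight

/-- The product basis of `[2] ⊗ [2] ⊗ [2]`. -/
noncomputable def basisVec (a b c : Fin 3) : TensorSpace := Pi.single (a, b, c) 1

theorem totalOp_mulVec_basisVec (A : Matrix (Fin 3) (Fin 3) ℂ) (a b c : Fin 3) :
    (totalOp A).mulVec (basisVec a b c) =
      ∑ i, A i a • basisVec i b c + ∑ i, A i b • basisVec a i c + ∑ i, A i c • basisVec a b i :=
  totalOp_mulVec_single A a b c

theorem totalOp_raising_basisVec (a b c : Fin 3) :
    (totalOp (raising 2)).mulVec (basisVec a b c) =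
      ![0, (2 : ℂ) • basisVec 0 b c, basisVec 1 b c] a +
      ![0, (2 : ℂ) • basisVec a 0 c, basisVec a 1 c] b +
      ![0, (2 : ℂ) • basisVec a b 0, basisVec a b 1] c := by
  rw [totalOp_mulVec_basisVec, raising_eq]
  congr 1 <;> [congr 1; skip]
  · rcases fin_three_cases a with rfl | rfl | rfl <;> simp [Fin.sum_univ_three]
  · rcases fin_three_cases b with rfl | rfl | rfl <;> simp [Fin.sum_univ_three]
  · rcases fin_three_cases c with rfl | rfl | rfl <;> simp [Fin.sum_univ_three]

theorem totalOp_lowering_basisVec (a b c : Fin 3) :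
    (totalOp (lowering 2)).mulVec (basisVec a b c) =
      ![basisVec 1 b c, (2 : ℂ) • basisVec 2 b c, 0] a +
      ![basisVec a 1 c, (2 : ℂ) • basisVec a 2 c, 0] b +
      ![basisVec a b 1, (2 : ℂ) • basisVec a b 2, 0] c := by
  rw [totalOp_mulVec_basisVec, lowering_eq]
  congr 1 <;> [congr 1; skip]
  · rcases fin_three_cases a with rfl | rfl | rfl <;> simp [Fin.sum_univ_three]
  · rcases fin_three_cases b with rfl | rfl | rfl <;> simp [Fin.sum_univ_three]
  · rcases fin_three_cases c with rfl | rfl | rfl <;> simp [Fin.sum_univ_three]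

theorem totalOp_spin_two_basisVec (a b c : Fin 3) :
    (totalOp (spin 2 2)).mulVec (basisVec a b c) =
      ((![1, 0, -1] : Fin 3 → ℂ) a + (![1, 0, -1] : Fin 3 → ℂ) b + (![1, 0, -1] : Fin 3 → ℂ) c) •
        basisVec a b c := by
  rw [totalOp_mulVec_basisVec, spin_two_eq, add_smul, add_smul]
  congr 1 <;> [congr 1; skip]
  · rcases fin_three_cases a with rfl | rfl | rfl <;> simp [Fin.sum_univ_three]
  · rcases fin_three_cases b with rfl | rfl | rfl <;> simp [Fin.sum_univ_three]
  · rcases fin_three_cases c with rfl | rfl | rfl <;> simp [Fin.sum_univ_three]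

/-- Linearly independent highest-weight vectors of `[2] ⊗ [2] ⊗ [2]`. -/
noncomputable def hwVec : Fin 7 → TensorSpace :=
  ![basisVec 0 0 0, basisVec 1 0 0 - basisVec 0 0 1, basisVec 0 1 0 - basisVec 0 0 1,
    basisVec 1 1 0 - (2 : ℂ) • basisVec 2 0 0 - (2 : ℂ) • basisVec 0 2 0,
    basisVec 1 0 1 - (2 : ℂ) • basisVec 2 0 0 - (2 : ℂ) • basisVec 0 0 2,
    basisVec 0 1 1 - (2 : ℂ) • basisVec 0 2 0 - (2 : ℂ) • basisVec 0 0 2,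
    basisVec 2 1 0 - basisVec 2 0 1 - basisVec 1 2 0 + basisVec 1 0 2 + basisVec 0 2 1 -
      basisVec 0 1 2]

theorem isHighestWeight_hwVec (i : Fin 7) :
    IsHighestWeight ((![3, 2, 2, 1, 1, 1, 0] : Fin 7 → ℂ) i) (hwVec i) := by
  constructor
  · fin_cases i <;>
    · simp [hwVec, Matrix.mulVec_add, Matrix.mulVec_sub, Matrix.mulVec_smul,
        totalOp_raising_basisVec]
      try module
  · fin_cases i <;>
    · simp [hwVec, Matrix.mulVec_add, Matrix.mulVec_sub, Matrix.mulVec_smul,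
        totalOp_spin_two_basisVec]
      try module

theorem basisVec_lowering {X : EndTensor 2 2 2} (hX : X ∈ spinCentralizer 2 2 2) {a b c : Fin 3}
    (h : X.mulVec (basisVec a b c) = 0) :
    X.mulVec (![basisVec 1 b c, (2 : ℂ) • basisVec 2 b c, 0] a) +
      X.mulVec (![basisVec a 1 c, (2 : ℂ) • basisVec a 2 c, 0] b) +
      X.mulVec (![basisVec a b 1, (2 : ℂ) • basisVec a b 2, 0] c) = 0 := by
  rw [← Matrix.mulVec_add, ← Matrix.mulVec_add, ← totalOp_lowering_basisVec, Matrix.mulVec_mulVec,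
    ← (totalOp_comm_of_mem hX).2.1, ← Matrix.mulVec_mulVec, h, Matrix.mulVec_zero]

/-- Highest-weight vectors generate the module under lowering. The proof descends by weight from 3
to -3: in each weight space, the lowered vectors from the level above and the highest-weight vectors
of that weight span. -/
theorem eq_zero_of_mulVec_hwVec {X : EndTensor 2 2 2} (hX : X ∈ spinCentralizer 2 2 2)
    (h : ∀ i, X.mulVec (hwVec i) = 0) : X = 0 := by
  obtain ⟨t, ht⟩ : ∃ t : Fin 3 → Fin 3 → Fin 3 → TensorSpace,
    ∀ a b c, X.mulVec (basisVec a b c) = t a b c := ⟨_, fun _ _ _ => rfl⟩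
  have low (a b c : Fin 3) (h0 : t a b c = 0) (q) :
      ![t 1 b c q, 2 * t 2 b c q, 0] a + ![t a 1 c q, 2 * t a 2 c q, 0] b +
        ![t a b 1 q, 2 * t a b 2 q, 0] c = 0 := by
    rw [← ht] at h0
    have := congrFun (basisVec_lowering hX h0) q
    refine Eq.trans ?_ this
    rw [Pi.add_apply, Pi.add_apply]
    congr 1 <;> [congr 1; skip]
    · rcases fin_three_cases a with rfl | rfl | rfl <;> simp [Matrix.mulVec_smul, ht]
    · rcases fin_three_cases b with rfl | rfl | rfl <;> simp [Matrix.mulVec_smul, ht]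
    · rcases fin_three_cases c with rfl | rfl | rfl <;> simp [Matrix.mulVec_smul, ht]
  have hw (i q) := congrFun (h i) q
  have w1 := hw 1
  have w2 := hw 2
  have w3 := hw 3
  have w4 := hw 4
  have w5 := hw 5
  have w6 := hw 6
  simp [hwVec, Matrix.mulVec_add, Matrix.mulVec_sub, Matrix.mulVec_smul, ht] at w1 w2 w3 w4 w5 w6
  have t000 : t 0 0 0 = 0 := by
    rw [← ht]
    exact h 0
  have level (q) : t 0 0 1 q = 0 ∧ t 0 1 0 q = 0 ∧ t 1 0 0 q = 0 := by
    have l000 := low 0 0 0 t000 q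
    simp at l000
    grind
  have t001 : t 0 0 1 = 0 := funext fun q => (level q).1
  have t010 : t 0 1 0 = 0 := funext fun q => (level q).2.1
  have t100 : t 1 0 0 = 0 := funext fun q => (level q).2.2
  clear level
  have level (q) : t 0 0 2 q = 0 ∧ t 0 1 1 q = 0 ∧ t 0 2 0 q = 0 ∧ t 1 0 1 q = 0 ∧ t 1 1 0 q =
    0 ∧ t 2 0 0 q = 0 := by
    have l001 := low 0 0 1 t001 q
    have l010 := low 0 1 0 t010 q
    have l100 := low 1 0 0 t100 q
    simp at l001 l010 l100
    grind
  have t002 : t 0 0 2 = 0 := funext fun q => (level q).1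
  have t011 : t 0 1 1 = 0 := funext fun q => (level q).2.1
  have t020 : t 0 2 0 = 0 := funext fun q => (level q).2.2.1
  have t101 : t 1 0 1 = 0 := funext fun q => (level q).2.2.2.1
  have t110 : t 1 1 0 = 0 := funext fun q => (level q).2.2.2.2.1
  have t200 : t 2 0 0 = 0 := funext fun q => (level q).2.2.2.2.2
  clear level
  have level (q) : t 0 1 2 q = 0 ∧ t 0 2 1 q = 0 ∧ t 1 0 2 q = 0 ∧ t 1 1 1 q = 0 ∧ t 1 2 0 q =
    0 ∧ t 2 0 1 q = 0 ∧ t 2 1 0 q = 0 := by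
    have l002 := low 0 0 2 t002 q
    have l011 := low 0 1 1 t011 q
    have l020 := low 0 2 0 t020 q
    have l101 := low 1 0 1 t101 q
    have l110 := low 1 1 0 t110 q
    have l200 := low 2 0 0 t200 q
    simp at l002 l011 l020 l101 l110 l200
    grind
  have t012 : t 0 1 2 = 0 := funext fun q => (level q).1
  have t021 : t 0 2 1 = 0 := funext fun q => (level q).2.1
  have t102 : t 1 0 2 = 0 := funext fun q => (level q).2.2.1
  have t111 : t 1 1 1 = 0 := funext fun q => (level q).2.2.2.1
  have t120 : t 1 2 0 = 0 := funext fun q => (level q).2.2.2.2.1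
  have t201 : t 2 0 1 = 0 := funext fun q => (level q).2.2.2.2.2.1
  have t210 : t 2 1 0 = 0 := funext fun q => (level q).2.2.2.2.2.2
  clear level
  have level (q) : t 0 2 2 q = 0 ∧ t 1 1 2 q = 0 ∧ t 1 2 1 q = 0 ∧ t 2 0 2 q = 0 ∧ t 2 1 1 q =
    0 ∧ t 2 2 0 q = 0 := by
    have l012 := low 0 1 2 t012 q
    have l021 := low 0 2 1 t021 q
    have l102 := low 1 0 2 t102 q
    have l111 := low 1 1 1 t111 q
    have l120 := low 1 2 0 t120 q
    have l201 := low 2 0 1 t201 q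
    have l210 := low 2 1 0 t210 q
    simp at l012 l021 l102 l111 l120 l201 l210
    grind
  have t022 : t 0 2 2 = 0 := funext fun q => (level q).1
  have t112 : t 1 1 2 = 0 := funext fun q => (level q).2.1
  have t121 : t 1 2 1 = 0 := funext fun q => (level q).2.2.1
  have t202 : t 2 0 2 = 0 := funext fun q => (level q).2.2.2.1
  have t211 : t 2 1 1 = 0 := funext fun q => (level q).2.2.2.2.1
  have t220 : t 2 2 0 = 0 := funext fun q => (level q).2.2.2.2.2
  clear level
  have level (q) : t 1 2 2 q = 0 ∧ t 2 1 2 q = 0 ∧ t 2 2 1 q = 0 := by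
    have l022 := low 0 2 2 t022 q
    have l112 := low 1 1 2 t112 q
    have l121 := low 1 2 1 t121 q
    have l202 := low 2 0 2 t202 q
    have l211 := low 2 1 1 t211 q
    have l220 := low 2 2 0 t220 q
    simp at l022 l112 l121 l202 l211 l220
    grind
  have t122 : t 1 2 2 = 0 := funext fun q => (level q).1
  have t212 : t 2 1 2 = 0 := funext fun q => (level q).2.1
  have t221 : t 2 2 1 = 0 := funext fun q => (level q).2.2
  clear level
  have level (q) : t 2 2 2 q = 0 := by
    have l122 := low 1 2 2 t122 q
    have l212 := low 2 1 2 t212 q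
    have l221 := low 2 2 1 t221 q
    simp at l122 l212 l221
    grind
  have t222 := funext level
  clear level
  refine Matrix.ext_of_mulVec_single fun ⟨a, b, c⟩ => ?_
  rw [Matrix.zero_mulVec]
  refine (ht a b c).trans ?_
  rcases fin_three_cases a with rfl | rfl | rfl <;> rcases fin_three_cases b with rfl | rfl | rfl
    <;>
    rcases fin_three_cases c with rfl | rfl | rfl <;> assumption

/-- Pairs of a highest-weight vector `u` and a coordinate of its image under an intertwiner. -/
def hwIndex : Fin 15 → Fin 7 × Fin 3 × Fin 3 × Fin 3 :=
  ![(0, 0, 0, 0), (1, 1, 0, 0), (1, 0, 1, 0), (2, 1, 0, 0), (2, 0, 1, 0),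
    (3, 1, 1, 0), (3, 1, 0, 1), (3, 0, 1, 1), (4, 1, 1, 0), (4, 1, 0, 1), (4, 0, 1, 1),
    (5, 1, 1, 0), (5, 1, 0, 1), (5, 0, 1, 1), (6, 2, 1, 0)]

/-- An intertwiner sends a highest-weight vector to one of the same weight, and a multiplicity m
costs m coordinates for each of m vectors: 1² + 2² + 3² + 1² = 15 numbers. -/
theorem eq_zero_of_hwIndex {X : EndTensor 2 2 2} (hX : X ∈ spinCentralizer 2 2 2)
    (h : ∀ n, X.mulVec (hwVec (hwIndex n).1) (hwIndex n).2 = 0) : X = 0 := by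
  refine eq_zero_of_mulVec_hwVec hX fun i => ?_
  have hw := (isHighestWeight_hwVec i).mulVec hX
  fin_cases i
  · exact IsHighestWeight.eq_zero_three hw (h 0)
  · exact IsHighestWeight.eq_zero_two hw (h 1) (h 2)
  · exact IsHighestWeight.eq_zero_two hw (h 3) (h 4)
  · exact IsHighestWeight.eq_zero_one hw (h 5) (h 6) (h 7)
  · exact IsHighestWeight.eq_zero_one hw (h 8) (h 9) (h 10)
  · exact IsHighestWeight.eq_zero_one hw (h 11) (h 12) (h 13)
  · exact IsHighestWeight.eq_zero_zero hw (h 14)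

theorem finrank_spinCentralizer_le : Module.finrank ℂ (spinCentralizer 2 2 2) ≤ 15 := by
  let f : spinCentralizer 2 2 2 →ₗ[ℂ] Fin 15 → ℂ :=
    { toFun := fun X n => (X : EndTensor 2 2 2).mulVec (hwVec (hwIndex n).1) (hwIndex n).2
      map_add' := fun X Y => by
        funext n
        simp only [Subalgebra.coe_add, Matrix.add_mulVec, Pi.add_apply]
      map_smul' := fun c X => by
        funext n
        simp only [Subalgebra.coe_smul, Matrix.smul_mulVec, Pi.smul_apply, RingHom.id_apply] }
  have hf : Function.Injective f := by
    rw [injective_iff_map_eq_zero]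
    intro X hX
    exact Subtype.ext (eq_zero_of_hwIndex X.2 fun n => congrFun hX n)
  simpa using LinearMap.finrank_le_finrank_of_injective hf

/-! ### The Casimirs as Brauer elements -/

theorem sum_spin_sq {R : Type*} [Ring R] [Algebra ℂ R] (S : Matrix (Fin 3) (Fin 3) ℂ → R)
    (hadd : ∀ A B, S (A + B) = S A + S B) (hsmul : ∀ (c : ℂ) A, S (c • A) = c • S A) :
    ∑ α, S (spin 2 α) ^ 2 = (1 / 2 : ℂ) •
      (S (raising 2) * S (lowering 2) + S (lowering 2) * S (raising 2)) + S (spin 2 2) ^ 2 := by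
  rw [Fin.sum_univ_three, raising_eq_spin, lowering_eq_spin, hadd, hadd, hsmul, hsmul]
  simp only [add_mul, mul_add, smul_mul_assoc, mul_smul_comm, sq]
  -- The cross terms cancel, and the square of the second component gets the coefficient -I² = 1.
  match_scalars <;> first | ring1 | linear_combination Complex.I_mul_I

/-- The sum over the first two sites of an operator on `[2]`. -/
def pairOp₁₂ (A : Matrix (Fin 3) (Fin 3) ℂ) : EndTensor 2 2 2 :=
  A ⊗ₖ (1 ⊗ₖ 1) + 1 ⊗ₖ (A ⊗ₖ 1)

/-- The sum over the last two sites of an operator on `[2]`. -/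
def pairOp₂₃ (A : Matrix (Fin 3) (Fin 3) ℂ) : EndTensor 2 2 2 :=
  1 ⊗ₖ (A ⊗ₖ 1) + 1 ⊗ₖ (1 ⊗ₖ A)

theorem pairOp₁₂_mulVec (A : Matrix (Fin 3) (Fin 3) ℂ) (f : TensorSpace) (i j k : Fin 3) :
    (pairOp₁₂ A).mulVec f (i, j, k) = ∑ a, A i a * f (a, j, k) + ∑ a, A j a * f (i, a, k) := by
  rw [pairOp₁₂, Matrix.add_mulVec, Pi.add_apply, siteOne_mulVec, siteTwo_mulVec]

theorem pairOp₂₃_mulVec (A : Matrix (Fin 3) (Fin 3) ℂ) (f : TensorSpace) (i j k : Fin 3) :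
    (pairOp₂₃ A).mulVec f (i, j, k) = ∑ a, A j a * f (i, a, k) + ∑ a, A k a * f (i, j, a) := by
  rw [pairOp₂₃, Matrix.add_mulVec, Pi.add_apply, siteTwo_mulVec, siteThree_mulVec]

theorem casimir_zero_one : casimir 2 2 2 {0, 1} = (1 / 2 : ℂ) •
    (pairOp₁₂ (raising 2) * pairOp₁₂ (lowering 2) + pairOp₁₂ (lowering 2) * pairOp₁₂ (raising 2)) +
      pairOp₁₂ (spin 2 2) ^ 2 := by
  rw [← sum_spin_sq pairOp₁₂]
  · simp only [casimir, Finset.sum_pair (show (0 : Fin 3) ≠ 1 by decide)]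
    rfl
  · intro A B
    simp only [pairOp₁₂, Matrix.add_kronecker, Matrix.kronecker_add]
    abel
  · intro c A
    simp only [pairOp₁₂, Matrix.smul_kronecker, Matrix.kronecker_smul, smul_add]

theorem casimir_one_two : casimir 2 2 2 {1, 2} = (1 / 2 : ℂ) •
    (pairOp₂₃ (raising 2) * pairOp₂₃ (lowering 2) + pairOp₂₃ (lowering 2) * pairOp₂₃ (raising 2)) +
      pairOp₂₃ (spin 2 2) ^ 2 := by
  rw [← sum_spin_sq pairOp₂₃]
  · simp only [casimir, Finset.sum_pair (show (1 : Fin 3) ≠ 2 by decide)]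
    rfl
  · intro A B
    simp only [pairOp₂₃, Matrix.add_kronecker, Matrix.kronecker_add]
    abel
  · intro c A
    simp only [pairOp₂₃, Matrix.smul_kronecker, Matrix.kronecker_smul, smul_add]

theorem casimir_zero_one_two : casimir 2 2 2 {0, 1, 2} = (1 / 2 : ℂ) •
    (totalOp (raising 2) * totalOp (lowering 2) + totalOp (lowering 2) * totalOp (raising 2)) +
      totalOp (spin 2 2) ^ 2 := by
  rw [← sum_spin_sq totalOp totalOp_add totalOp_smul]
  have h : ({0, 1, 2} : Finset (Fin 3)) = Finset.univ := by decide
  simp only [casimir, h, Fin.sum_univ_three]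
  rfl

theorem casimir_zero_one_mulVec (f : TensorSpace) (i j k : Fin 3) :
    (casimir 2 2 2 {0, 1}).mulVec f (i, j, k) = (2 * (swap₁₂ - cap₁₂) + 4 :
      Module.End ℂ TensorSpace) f (i, j, k) := by
  simp only [casimir_zero_one, Matrix.add_mulVec, Matrix.smul_mulVec, sq, ← Matrix.mulVec_mulVec,
    ofNat_eq_smul_one (R := Module.End ℂ TensorSpace), smul_mul_assoc, one_mul,
    LinearMap.add_apply, LinearMap.sub_apply, LinearMap.smul_apply, Module.End.one_apply,
    Pi.add_apply, Pi.sub_apply, Pi.smul_apply, smul_eq_mul, pairOp₁₂_mulVec, swap₁₂_apply,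
    cap₁₂_apply, Fin.sum_univ_three, raising_eq, lowering_eq, spin_two_eq]
  rcases fin_three_cases i with rfl | rfl | rfl <;> rcases fin_three_cases j with rfl | rfl | rfl
    <;>
    simp [invVec_apply] <;> ring

theorem casimir_one_two_mulVec (f : TensorSpace) (i j k : Fin 3) :
    (casimir 2 2 2 {1, 2}).mulVec f (i, j, k) = (2 * (swap₂₃ - cap₂₃) + 4 :
      Module.End ℂ TensorSpace) f (i, j, k) := by
  simp only [casimir_one_two, Matrix.add_mulVec, Matrix.smul_mulVec, sq, ← Matrix.mulVec_mulVec,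
    ofNat_eq_smul_one (R := Module.End ℂ TensorSpace), smul_mul_assoc, one_mul,
    LinearMap.add_apply, LinearMap.sub_apply, LinearMap.smul_apply, Module.End.one_apply,
    Pi.add_apply, Pi.sub_apply, Pi.smul_apply, smul_eq_mul, pairOp₂₃_mulVec, swap₂₃_apply,
    cap₂₃_apply, Fin.sum_univ_three, raising_eq, lowering_eq, spin_two_eq]
  rcases fin_three_cases j with rfl | rfl | rfl <;> rcases fin_three_cases k with rfl | rfl | rfl
    <;>
    simp [invVec_apply] <;> ring

theorem casimir_zero_one_two_mulVec (f : TensorSpace) (i j k : Fin 3) :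
    (casimir 2 2 2 {0, 1, 2}).mulVec f (i, j, k) =
      (2 * (swap₁₂ - cap₁₂ + (swap₂₃ - cap₂₃) + (swap₁₃ - cap₁₃)) + 6 :
        Module.End ℂ TensorSpace) f (i, j, k) := by
  simp only [casimir_zero_one_two, Matrix.add_mulVec, Matrix.smul_mulVec, sq,
    ← Matrix.mulVec_mulVec,
    ofNat_eq_smul_one (R := Module.End ℂ TensorSpace), smul_mul_assoc, one_mul,
    LinearMap.add_apply, LinearMap.sub_apply, LinearMap.smul_apply, Module.End.one_apply,
    Pi.add_apply, Pi.sub_apply, Pi.smul_apply, smul_eq_mul, totalOp_mulVec, swap₂₃_apply,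
    cap₂₃_apply, swap₁₂_apply, cap₁₂_apply, swap₁₃_apply, cap₁₃_apply,
    Fin.sum_univ_three, raising_eq, lowering_eq, spin_two_eq]
  rcases fin_three_cases i with rfl | rfl | rfl <;>
    rcases fin_three_cases j with rfl | rfl | rfl <;>
    rcases fin_three_cases k with rfl | rfl | rfl <;>
    simp [invVec_apply] <;> ring

/-! ### The Brauer image lies in the centralizer and fills it -/

theorem swap_mulVec_totalOp (A : Matrix (Fin 3) (Fin 3) ℂ) (f : TensorSpace) (i j k : Fin 3) :
    swap₁₂ ((totalOp A).mulVec f) (i, j, k) = (totalOp A).mulVec (swap₁₂ f) (i, j, k) ∧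
    swap₂₃ ((totalOp A).mulVec f) (i, j, k) = (totalOp A).mulVec (swap₂₃ f) (i, j, k) := by
  constructor <;> simp only [swap₁₂_apply, swap₂₃_apply, totalOp_mulVec] <;> ring

theorem mem_spinCentralizer_of_comm {X : EndTensor 2 2 2}
    (h₁ : totalOp (raising 2) * X = X * totalOp (raising 2))
    (h₂ : totalOp (lowering 2) * X = X * totalOp (lowering 2))
    (h₃ : totalOp (spin 2 2) * X = X * totalOp (spin 2 2)) : X ∈ spinCentralizer 2 2 2 := by
  have e₀ : spin 2 0 = (1 / 2 : ℂ) • (raising 2 + lowering 2) := rfl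
  have e₁ : spin 2 1 = (-Complex.I / 2) • (raising 2 + (-1 : ℂ) • lowering 2) := by
    rw [neg_one_smul, ← sub_eq_add_neg]
    rfl
  rw [mem_spinCentralizer_iff]
  intro α
  rcases fin_three_cases α with rfl | rfl | rfl
  · rw [e₀, totalOp_smul, totalOp_add, smul_mul_assoc, mul_smul_comm, add_mul, mul_add, h₁, h₂]
  · rw [e₁, totalOp_smul, totalOp_add, totalOp_smul, smul_mul_assoc, mul_smul_comm, add_mul,
      mul_add, smul_mul_assoc, mul_smul_comm, h₁, h₂]
  · exact h₃

theorem cap_mulVec_totalOp (f : TensorSpace) (i j k : Fin 3) (A : Matrix (Fin 3) (Fin 3) ℂ)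
    (hA : A = raising 2 ∨ A = lowering 2 ∨ A = spin 2 2) :
    cap₁₂ ((totalOp A).mulVec f) (i, j, k) = (totalOp A).mulVec (cap₁₂ f) (i, j, k) ∧
    cap₂₃ ((totalOp A).mulVec f) (i, j, k) = (totalOp A).mulVec (cap₂₃ f) (i, j, k) := by
  constructor
  · simp only [cap₁₂_apply, totalOp_mulVec]
    rcases fin_three_cases i with rfl | rfl | rfl <;>
      rcases fin_three_cases j with rfl | rfl | rfl <;> rcases hA with rfl | rfl | rfl <;>
      simp [Fin.sum_univ_three, invVec_apply, raising_eq, lowering_eq, spin_two_eq] <;> ring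
  · simp only [cap₂₃_apply, totalOp_mulVec]
    rcases fin_three_cases k with rfl | rfl | rfl <;>
      rcases fin_three_cases j with rfl | rfl | rfl <;> rcases hA with rfl | rfl | rfl <;>
      simp [Fin.sum_univ_three, invVec_apply, raising_eq, lowering_eq, spin_two_eq] <;> ring

theorem toMatrix_mem_spinCentralizer {T : Module.End ℂ TensorSpace}
    (h : ∀ A : Matrix (Fin 3) (Fin 3) ℂ, A = raising 2 ∨ A = lowering 2 ∨ A = spin 2 2 →
      ∀ (f : TensorSpace) (i j k : Fin 3),
        T ((totalOp A).mulVec f) (i, j, k) = (totalOp A).mulVec (T f) (i, j, k)) :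
    LinearMap.toMatrixAlgEquiv' T ∈ spinCentralizer 2 2 2 := by
  have key (A) (hA : A = raising 2 ∨ A = lowering 2 ∨ A = spin 2 2) :
    totalOp A * LinearMap.toMatrixAlgEquiv' T =
      LinearMap.toMatrixAlgEquiv' T * totalOp A := by
    refine Matrix.mulVec_injective (funext fun f => funext fun ⟨i, j, k⟩ => ?_)
    have e (w : TensorSpace) : (LinearMap.toMatrixAlgEquiv' T).mulVec w = T w := by
      rw [← Matrix.toLinAlgEquiv'_apply, Matrix.toLinAlgEquiv'_toMatrixAlgEquiv']
    rw [← Matrix.mulVec_mulVec, ← Matrix.mulVec_mulVec, e, e]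
    exact (h A hA f i j k).symm
  exact mem_spinCentralizer_of_comm (key _ (Or.inl rfl)) (key _ (Or.inr (Or.inl rfl)))
    (key _ (Or.inr (Or.inr rfl)))

theorem toMatrix_brauer_rep_mem {g : BrauerAlgebra 3 →ₐ[ℂ] Module.End ℂ TensorSpace}
    (h₁ : g (brauerGen 3 .s₁) = swap₁₂) (h₂ : g (brauerGen 3 .s₂) = swap₂₃)
    (h₃ : g (brauerGen 3 .e₁) = cap₁₂) (h₄ : g (brauerGen 3 .e₂) = cap₂₃) (x : BrauerAlgebra 3) :
    LinearMap.toMatrixAlgEquiv' (g x) ∈ spinCentralizer 2 2 2 := by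
  obtain ⟨y, rfl⟩ := RingQuot.mkAlgHom_surjective ℂ (BrauerRel 3) x
  induction y using FreeAlgebra.induction with
  | grade0 c =>
    rw [AlgHom.commutes, AlgHom.commutes, AlgEquiv.commutes]
    exact Subalgebra.algebraMap_mem _ c
  | grade1 b =>
    change LinearMap.toMatrixAlgEquiv' (g (brauerGen 3 b)) ∈ _
    refine toMatrix_mem_spinCentralizer fun A hA f i j k => ?_
    cases b
    · rw [h₁]
      exact (swap_mulVec_totalOp A f i j k).1
    · rw [h₂]
      exact (swap_mulVec_totalOp A f i j k).2
    · rw [h₃]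
      exact (cap_mulVec_totalOp f i j k A hA).1
    · rw [h₄]
      exact (cap_mulVec_totalOp f i j k A hA).2
  | mul a b ha hb =>
    rw [map_mul, map_mul, map_mul]
    exact mul_mem ha hb
  | add a b ha hb =>
    rw [map_add, map_add, map_add]
    exact add_mem ha hb

theorem toMatrix_eq_casimir {T : Module.End ℂ TensorSpace} {X : EndTensor 2 2 2}
    (h : ∀ (f : TensorSpace) (i j k : Fin 3), X.mulVec f (i, j, k) = T f (i, j, k)) :
    LinearMap.toMatrixAlgEquiv' T = X := by
  refine Matrix.toLinAlgEquiv'.injective ?_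
  rw [Matrix.toLinAlgEquiv'_toMatrixAlgEquiv']
  exact LinearMap.ext fun f => funext fun ⟨i, j, k⟩ => (h f i j k).symm

theorem exists_algEquiv_of_finrank_le {Q B S : Type*} [Semiring Q] [Algebra ℂ Q] [Ring B]
    [Algebra ℂ B] [Ring S] [Algebra ℂ S] [FiniteDimensional ℂ S] {n : ℕ} {W : Subalgebra ℂ S}
    (ψ : Q ≃ₐ[ℂ] B) (f : B →ₐ[ℂ] S)
    (hf : Function.Injective f) (hmem : ∀ x, f x ∈ W) (hB : Module.finrank ℂ B = n)
    (hW : Module.finrank ℂ W ≤ n) : ∃ φ : Q ≃ₐ[ℂ] W, ∀ x, (φ x : S) = f (ψ x) := by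
  let u : B →ₐ[ℂ] W := f.codRestrict W hmem
  have hu : Function.Injective u := fun x y h => hf (congrArg Subtype.val h)
  have : FiniteDimensional ℂ B := FiniteDimensional.of_injective u.toLinearMap hu
  have heq : Module.finrank ℂ B = Module.finrank ℂ W :=
    le_antisymm (LinearMap.finrank_le_finrank_of_injective (f := u.toLinearMap) hu) (hB ▸ hW)
  have hs : Function.Surjective u :=
    (LinearMap.injective_iff_surjective_of_finrank_eq_finrank (f := u.toLinearMap) heq).1 hu
  exact ⟨ψ.trans (AlgEquiv.ofBijective u ⟨hu, hs⟩), fun _ => rfl⟩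

theorem exists_algEquiv_spinCentralizer :
    ∃ φ : QuotientRacah 2 2 2 ≃ₐ[ℂ] spinCentralizer 2 2 2,
      (φ (quotGen 2 2 2 .A) : EndTensor 2 2 2) = casimir 2 2 2 {0, 1} ∧
      (φ (quotGen 2 2 2 .B) : EndTensor 2 2 2) = casimir 2 2 2 {1, 2} ∧
      (φ (quotGen 2 2 2 .C) : EndTensor 2 2 2) = casimir 2 2 2 {0, 1, 2} := by
  obtain ⟨ψ, hA, hB, hC⟩ := exists_algEquiv_brauer
  obtain ⟨g, ⟨h₁, h₂, h₃, h₄⟩, hg, hfin⟩ := exists_brauer_rep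
  obtain ⟨φ, hφ⟩ := exists_algEquiv_of_finrank_le (W := spinCentralizer 2 2 2) ψ
    (LinearMap.toMatrixAlgEquiv'.toAlgHom.comp g)
    (LinearMap.toMatrixAlgEquiv'.injective.comp hg)
    (toMatrix_brauer_rep_mem h₁ h₂ h₃ h₄) hfin finrank_spinCentralizer_le
  have e (x : QuotientRacah 2 2 2) (y : BrauerAlgebra 3) (h : ψ x = y) :
      (φ x : EndTensor 2 2 2) = LinearMap.toMatrixAlgEquiv' (g y) := by
    rw [hφ, h]
    rfl
  refine ⟨φ, (e _ _ hA).trans (toMatrix_eq_casimir ?_), (e _ _ hB).trans (toMatrix_eq_casimir ?_),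
    (e _ _ hC).trans (toMatrix_eq_casimir ?_)⟩
  · simp only [map_add, map_mul, map_sub, map_ofNat, h₁, h₃]
    exact casimir_zero_one_mulVec
  · simp only [map_add, map_mul, map_sub, map_ofNat, h₂, h₄]
    exact casimir_one_two_mulVec
  · simp only [map_add, map_mul, map_sub, map_ofNat, h₁, h₂, h₃, h₄, swap_conj_swap, swap_conj_cap]
    exact casimir_zero_one_two_mulVec

end RacahCentralizer

theorem mainTheorem4 :
    -- the quotiented Racah algebra for the spins `1, 1, 1` has dimension 15
    Module.finrank ℂ (RacahCentralizer.QuotientRacah 2 2 2) = 15 ∧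
    -- it is isomorphic to the centralizer through the intermediate Casimirs
    (∃ φ : RacahCentralizer.QuotientRacah 2 2 2 ≃ₐ[ℂ] RacahCentralizer.spinCentralizer 2 2 2,
      (φ (RacahCentralizer.quotGen 2 2 2 .A) : RacahCentralizer.EndTensor 2 2 2)
          = RacahCentralizer.casimir 2 2 2 {0, 1} ∧
      (φ (RacahCentralizer.quotGen 2 2 2 .B) : RacahCentralizer.EndTensor 2 2 2)
          = RacahCentralizer.casimir 2 2 2 {1, 2} ∧
      (φ (RacahCentralizer.quotGen 2 2 2 .C) : RacahCentralizer.EndTensor 2 2 2)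
          = RacahCentralizer.casimir 2 2 2 {0, 1, 2}) ∧
    -- it is isomorphic to the Brauer algebra, by an isomorphism determined by its values at `A`, `B`
    (∃! ψ : RacahCentralizer.QuotientRacah 2 2 2 ≃ₐ[ℂ] RacahCentralizer.BrauerAlgebra 3,
      ψ (RacahCentralizer.quotGen 2 2 2 .A)
          = 2 * (RacahCentralizer.brauerGen 3 .s₁ - RacahCentralizer.brauerGen 3 .e₁) + 4 ∧
      ψ (RacahCentralizer.quotGen 2 2 2 .B)
          = 2 * (RacahCentralizer.brauerGen 3 .s₂ - RacahCentralizer.brauerGen 3 .e₂) + 4) := by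
  obtain ⟨ψ, hA, hB, -⟩ := RacahCentralizer.exists_algEquiv_brauer
  obtain ⟨-, -, -, hfin⟩ := RacahCentralizer.exists_brauer_rep
  refine ⟨ψ.toLinearEquiv.finrank_eq.trans hfin, RacahCentralizer.exists_algEquiv_spinCentralizer,
    ψ, ⟨hA, hB⟩, fun χ ⟨hA', hB'⟩ => ?_⟩
  -- Uniqueness holds because `A` and `B` generate the algebra.
  have h := RacahCentralizer.quotientRacah_hom_ext (R := RacahCentralizer.BrauerAlgebra 3)
    (f := χ.toAlgHom) (g := ψ.toAlgHom) (hA'.trans hA.symm) (hB'.trans hB.symm)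
  exact AlgEquiv.ext fun x => DFunLike.congr_fun h x
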